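/- Let $\mathbb S^1=\mathbb R/2\pi\mathbb Z$, identified with the unit circle of $\mathbb C$ by $x\mapsto e^{ix}$. For $\sigma\ge 0$ let $H^\sigma$ be the space of real functions $u\in L^2(\mathbb S^1)$ with $\|u\|_{H^\sigma}:=\big(\sum_{n\in\mathbb Z}(1+n^2)^\sigma|\hat u_n|^2\big)^{1/2}<\infty$. For $q>3/2$ let $D^q$ be the set of orientation preserving homeomorphisms $\varphi$ of $\mathbb S^1$ such that $\varphi$ and $\varphi^{-1}$ are of class $H^q$ (i.e. the $2\pi$-periodic parts of their lifts to $\mathbb R$ lie in $H^q$), with its usual Hilbert manifold structure (the local charts are the local inverses of $f\mapsto \mathrm{id}+f$, $f\in H^q$, $1+f_x>0$), and put $$d_q(\varphi_1,\varphi_2):=\max_{x\in\mathbb S^1}|\varphi_2(x)-\varphi_1(x)|+\|\varphi_{1x}-\varphi_{2x}\|_{H^{q-1}}+\|1/\varphi_{1x}-1/\varphi_{2x}\|_\infty .$$ Let $r\ge 1$ and let $A=\mathrm{op}(a(k))$ be a Fourier multiplier acting on real functions, with real symbol $a:\mathbb Z\to\mathbb R$, $a(-k)=a(k)$, such that (a)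 $|a(k)|\le C(1+k^2)^{r/2}$ for all $k$, for some constant $C$; (b) $a(k)\ne 0$ and $|1/a(k)|\le C'(1+k^2)^{-r/2}$ for all $k$, for some constant $C'$; (c) for every $p>3/2$ with $p\ge r$, the map $\varphi\mapsto A_\varphi$, $A_\varphi v:=(A(v\circ\varphi^{-1}))\circ\varphi$, is a smooth map from $D^p$ to the space $\mathcal L(H^p,H^{p-r})$ of bounded operators with the operator norm. Put $S(u):=A^{-1}\{[A,u]u_x-2(Au)u_x\}$, where $[A,u]u_x=A(uu_x)-uAu_x$, the products being taken in the sense of periodic distributions, and $S_\varphi(v):=S(v\circ\varphi^{-1})\circ\varphi$. **Theorem.** Let $q>3/2$ with $q\ge r$. Then $S_\varphi(v)$ is a well-defined element of $H^q$ for all $(\varphi,v)\in D^q\times H^q$, and the geodesic spray $$F_q:D^q\times H^q\to H^q\times H^q,\qquad F_q(\varphi,v)=(v,S_\varphi(v)),$$ is bounded on bounded sets: it maps every subset of $D^q\times H^q$ that is bounded for the distance $d_q(\varphi_1,\varphi_2)+\|v_1-v_2\|_{H^q}$ to a bounded subset of $H^q\times H^q$. -/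

import Mathlib

open MeasureTheory AddCircle
open scoped ContDiff

noncomputable section

namespace SprayBounded

/-- The circle `ℝ / 2πℤ`, identified with the unit circle of `ℂ` by `x ↦ exp (i x)`
(this is `AddCircle.toCircle`). -/
abbrev T : Type := AddCircle (2 * Real.pi)

instance instFactPeriod : Fact (0 < 2 * Real.pi) := ⟨Real.two_pi_pos⟩

/-- The normalised Haar measure `dx / 2π` on the circle. -/
abbrev haar : Measure T := haarAddCircle

/-! ### Sobolev spaces of real functions on the circle -/

/-- The `n`-th Fourier coefficient `(1 / 2π) ∫ u(x) exp (-i n x) dx` of a real function `u`. -/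
def coeff (u : T → ℝ) (n : ℤ) : ℂ := fourierCoeff (fun x => (u x : ℂ)) n

/-- `u` is square integrable with `∑ (1 + n²)^σ |û_n|² < ∞` (used for `σ ≥ 0`). -/
def MemSob (σ : ℝ) (u : T → ℝ) : Prop :=
  MemLp u 2 haar ∧ Summable fun n : ℤ => (1 + (n : ℝ) ^ 2) ^ σ * ‖coeff u n‖ ^ 2

/-- The Sobolev norm `(∑ (1 + n²)^σ |û_n|²)^(1/2)`. -/
def sobNorm (σ : ℝ) (u : T → ℝ) : ℝ :=
  Real.sqrt (∑' n : ℤ, (1 + (n : ℝ) ^ 2) ^ σ * ‖coeff u n‖ ^ 2)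

theorem coeff_congr {u v : T → ℝ} (h : u =ᵐ[haar] v) : coeff u = coeff v := by
  funext n
  exact congrFun (fourierCoeff_congr_ae (h.mono fun x hx => by simp [hx])) n

theorem integrable_ofReal (u : Lp ℝ 2 haar) : Integrable (fun x => ((u x : ℝ) : ℂ)) haar :=
  ((Lp.memLp u).integrable (by norm_num)).ofReal

theorem coeff_add (u v : Lp ℝ 2 haar) (n : ℤ) :
    coeff (u + v : Lp ℝ 2 haar) n = coeff u n + coeff v n := by
  rw [coeff_congr (Lp.coeFn_add u v)]
  have h := congrFun (fourierCoeff.add (integrable_ofReal u) (integrable_ofReal v)) n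
  simp only [coeff, Pi.add_apply, Complex.ofReal_add]
  exact h

theorem coeff_smul (c : ℝ) (u : Lp ℝ 2 haar) (n : ℤ) :
    coeff (c • u : Lp ℝ 2 haar) n = (c : ℂ) * coeff u n := by
  rw [coeff_congr (Lp.coeFn_smul c u)]
  have h := fourierCoeff.const_mul (fun x => ((u x : ℝ) : ℂ)) (c : ℂ) n
  simp only [coeff, Pi.smul_apply, smul_eq_mul, Complex.ofReal_mul]
  exact h

theorem coeff_zero (n : ℤ) : coeff (0 : Lp ℝ 2 haar) n = 0 := by
  have h := coeff_smul 0 0 n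
  simpa using h

theorem eq_zero_of_coeff (u : Lp ℝ 2 haar) (h : ∀ n, coeff u n = 0) : u = 0 := by
  have hm : MemLp (fun x : T => ((u x : ℝ) : ℂ)) 2 haar := (Lp.memLp u).ofReal
  have h0 : hm.toLp (fun x : T => ((u x : ℝ) : ℂ)) = 0 := by
    apply fourierBasis.repr.injective
    ext n
    rw [map_zero, fourierBasis_repr]
    exact (congrFun (fourierCoeff_congr_ae hm.coeFn_toLp) n).trans (h n)
  have h1 : (fun x : T => ((u x : ℝ) : ℂ)) =ᵐ[haar] (0 : T → ℂ) :=
    (hm.coeFn_toLp).symm.trans (by rw [h0]; exact Lp.coeFn_zero ℂ 2 haar)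
  rw [Lp.eq_zero_iff_ae_eq_zero]
  exact h1.mono fun x hx => by simpa using hx

/-- The functions of class `H^σ`, as a subspace of `L²`. -/
def sobSubmodule (σ : ℝ) : Submodule ℝ (Lp ℝ 2 haar) where
  carrier := {u | Summable fun n : ℤ => (1 + (n : ℝ) ^ 2) ^ σ * ‖coeff u n‖ ^ 2}
  zero_mem' := by
    change Summable fun n : ℤ => (1 + (n : ℝ) ^ 2) ^ σ * ‖coeff (0 : Lp ℝ 2 haar) n‖ ^ 2
    simp only [coeff_zero, norm_zero, ne_eq, OfNat.ofNat_ne_zero, not_false_eq_true, zero_pow,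
      mul_zero]
    exact summable_zero
  add_mem' := by
    intro u v hu hv
    refine Summable.of_nonneg_of_le (fun n => by positivity) (fun n => ?_)
      ((hu.add hv).mul_left 2)
    have hw : 0 ≤ (1 + (n : ℝ) ^ 2) ^ σ := by positivity
    have h1 : ‖coeff (u + v : Lp ℝ 2 haar) n‖ ≤ ‖coeff u n‖ + ‖coeff v n‖ := by
      rw [coeff_add]; exact norm_add_le _ _
    have h2 : ‖coeff (u + v : Lp ℝ 2 haar) n‖ ^ 2 ≤ 2 * (‖coeff u n‖ ^ 2 + ‖coeff v n‖ ^ 2) := by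
      have h3 := pow_le_pow_left₀ (norm_nonneg _) h1 2
      nlinarith [sq_nonneg (‖coeff u n‖ - ‖coeff v n‖)]
    have h4 := mul_le_mul_of_nonneg_left h2 hw
    linarith
  smul_mem' := by
    intro c u hu
    refine (Summable.mul_left (c ^ 2) hu).congr fun n => ?_
    rw [coeff_smul, norm_mul, Complex.norm_real, mul_pow, Real.norm_eq_abs, sq_abs]
    ring

/-- The Sobolev space `H^σ` of real functions on the circle (`σ ≥ 0`); its elements are classes of
square integrable functions and its norm is the Sobolev norm `sobNorm σ`. -/
def H (σ : ℝ) : Type := sobSubmodule σ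

instance instAddCommGroupH (σ : ℝ) : AddCommGroup (H σ) :=
  inferInstanceAs (AddCommGroup (sobSubmodule σ))

instance instModuleH (σ : ℝ) : Module ℝ (H σ) :=
  inferInstanceAs (Module ℝ (sobSubmodule σ))

/-- A representative of an element of `H^σ`. -/
instance instCoeFunH (σ : ℝ) : CoeFun (H σ) fun _ => T → ℝ := ⟨fun u => (u.1 : T → ℝ)⟩

theorem memlp_weighted {σ : ℝ} (u : H σ) :
    Memℓp (fun n : ℤ => (((1 + (n : ℝ) ^ 2) ^ (σ / 2) : ℝ) : ℂ) * coeff u n) 2 := by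
  refine memℓp_gen (u.2.congr fun n => ?_)
  have h0 : (0 : ℝ) ≤ 1 + (n : ℝ) ^ 2 := by positivity
  have h1 : ((1 + (n : ℝ) ^ 2) ^ (σ / 2)) ^ 2 = (1 + (n : ℝ) ^ 2) ^ σ := by
    rw [← Real.rpow_natCast, ← Real.rpow_mul h0]
    norm_num
  simp only [ENNReal.toReal_ofNat, Real.rpow_ofNat]
  rw [norm_mul, Complex.norm_real, mul_pow, Real.norm_eq_abs, sq_abs, h1]

/-- The embedding `u ↦ ((1 + n²)^(σ/2) û_n)_n` of `H^σ` into `ℓ²(ℤ)`. -/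
def weighted (σ : ℝ) : H σ →ₗ[ℝ] lp (fun _ : ℤ => ℂ) 2 where
  toFun u := ⟨_, memlp_weighted u⟩
  map_add' u v := by
    ext n
    change _ * coeff (u.1 + v.1 : Lp ℝ 2 haar) n = _ * coeff u n + _ * coeff v n
    rw [coeff_add]; ring
  map_smul' c u := by
    ext n
    change _ * coeff (c • u.1 : Lp ℝ 2 haar) n = c • (_ * coeff u n)
    rw [coeff_smul, Complex.real_smul]; ring

theorem weighted_injective (σ : ℝ) : Function.Injective (weighted σ) := by
  rw [injective_iff_map_eq_zero]
  intro u hu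
  refine Subtype.ext (eq_zero_of_coeff u.1 fun n => ?_)
  have h := congrFun (congrArg Subtype.val hu) n
  have h' : (((1 + (n : ℝ) ^ 2) ^ (σ / 2) : ℝ) : ℂ) * coeff u n = 0 := h
  rcases mul_eq_zero.1 h' with h1 | h1
  · exfalso
    have : 0 < (1 + (n : ℝ) ^ 2) ^ (σ / 2) := by positivity
    exact this.ne' (by exact_mod_cast h1)
  · exact h1

instance instNormedAddCommGroupH (σ : ℝ) : NormedAddCommGroup (H σ) :=
  NormedAddCommGroup.induced (H σ) (lp (fun _ : ℤ => ℂ) 2) (weighted σ) (weighted_injective σ)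

instance instNormedSpaceH (σ : ℝ) : NormedSpace ℝ (H σ) :=
  NormedSpace.induced ℝ (H σ) (lp (fun _ : ℤ => ℂ) 2) (weighted σ)

theorem norm_eq_sobNorm {σ : ℝ} (u : H σ) : ‖u‖ = sobNorm σ u := by
  change ‖weighted σ u‖ = _
  rw [lp.norm_eq_tsum_rpow (by norm_num), sobNorm, Real.sqrt_eq_rpow]
  simp only [ENNReal.toReal_ofNat, Real.rpow_ofNat]
  congr 1
  refine tsum_congr fun n => ?_
  change ‖(((1 + (n : ℝ) ^ 2) ^ (σ / 2) : ℝ) : ℂ) * coeff u n‖ ^ 2 = _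
  have h0 : (0 : ℝ) ≤ 1 + (n : ℝ) ^ 2 := by positivity
  have h1 : ((1 + (n : ℝ) ^ 2) ^ (σ / 2)) ^ 2 = (1 + (n : ℝ) ^ 2) ^ σ := by
    rw [← Real.rpow_natCast, ← Real.rpow_mul h0]
    norm_num
  rw [norm_mul, Complex.norm_real, mul_pow, Real.norm_eq_abs, sq_abs, h1]

/-! ### Diffeomorphisms of class `H^q` -/

/-- `φ` has the continuous increasing lift `x ↦ x + f x`, where `f` is `2π`-periodic. A homeomorphism
of the circle preserves the orientation iff it has such a lift. -/
def IsDisplacement (φ : T → T) (f : T → ℝ) : Prop :=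
  Continuous f ∧ (StrictMono fun t : ℝ => t + f (t : T)) ∧ ∀ x : T, φ x = x + ((f x : ℝ) : T)

/-- `D^q` (used for `q > 3/2`): the orientation preserving homeomorphisms `φ` of the circle such that
`φ` and its inverse are of class `H^q`; a map of the circle to itself is of class `H^q` if
the periodic part of its lift is. -/
structure D (q : ℝ) where
  toHomeo : T ≃ₜ T
  exists_displacement : ∃ f, IsDisplacement toHomeo f ∧ MemSob q f
  exists_displacement_symm : ∃ f, IsDisplacement toHomeo.symm f ∧ MemSob q f

/-- The periodic part of a lift of `φ` (unique up to a constant in `2πℤ`). -/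
def D.displacement {q : ℝ} (φ : D q) : T → ℝ := φ.exists_displacement.choose

/-- The derivative `φ_x` of a diffeomorphism of the circle, a real function on the circle. -/
def D.deriv {q : ℝ} (φ : D q) (x : T) : ℝ :=
  1 + _root_.deriv (fun t : ℝ => φ.displacement (x + (t : T))) 0

/-- The distance `d_q`; points of the circle are compared in `ℂ`. -/
def dq {q : ℝ} (φ ψ : D q) : ℝ :=
  (⨆ x : T, ‖((toCircle (ψ.toHomeo x) : Circle) : ℂ) - ((toCircle (φ.toHomeo x) : Circle) : ℂ)‖) +
    sobNorm (q - 1) (fun x => φ.deriv x - ψ.deriv x) +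
    ⨆ x : T, |1 / φ.deriv x - 1 / ψ.deriv x|

/-- The elements `f` of `H^q` such that `id + f` is (a lift of) a diffeomorphism `φ` in `D^q`. -/
def IsChart {q : ℝ} (f : H q) (φ : D q) : Prop :=
  ∀ᵐ x ∂haar, φ.toHomeo x = x + ((f x : ℝ) : T)

/-- The domain of the parametrization `f ↦ id + f` of `D^q`: an open subset of `H^q`, namely
`1 + f_x > 0`. The parametrization is the quotient map by the translations by constants in `2πℤ`, and
its local inverses are the charts of the Hilbert manifold `D^q`. -/
def chartDomain (q : ℝ) : Set (H q) := {f | ∃ φ : D q, IsChart f φ}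

/-! ### The inertia operator and the geodesic spray -/

/-- `w = A u` for the Fourier multiplier `A = op(a)`. -/
def IsMultiplier (a : ℤ → ℝ) (u w : T → ℝ) : Prop := ∀ n, coeff w n = (a n : ℂ) * coeff u n

/-- `w = A_φ v = (A (v ∘ φ⁻¹)) ∘ φ`. -/
def IsConjugate (a : ℤ → ℝ) {q : ℝ} (φ : D q) (v w : T → ℝ) : Prop :=
  IsMultiplier a (fun x => v (φ.toHomeo.symm x)) (fun x => w (φ.toHomeo.symm x))

/-- The map `φ ↦ A_φ` from the Hilbert manifold `D^q` to `L(H^q, H^(q-r))` is well defined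
and smooth: in the charts of `D^q` it is a `C^∞` map for the operator norm. -/
def SmoothConjugation (a : ℤ → ℝ) (r q : ℝ) : Prop :=
  ∃ L : H q → (H q →L[ℝ] H (q - r)),
    ContDiffOn ℝ ∞ L (chartDomain q) ∧
      ∀ (f : H q) (φ : D q), IsChart f φ → ∀ v : H q, IsConjugate a φ v (L f v)

/-- The conditions on the inertia operator `A = op(a)`, a symmetric Fourier multiplier acting on real
functions. -/
structure IsInertia (a : ℤ → ℝ) (r : ℝ) : Prop where
  one_le : 1 ≤ r
  even : ∀ k, a (-k) = a k
  order : ∃ C : ℝ, ∀ k : ℤ, |a k| ≤ C * (1 + (k : ℝ) ^ 2) ^ (r / 2)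
  ne_zero : ∀ k, a k ≠ 0
  order_inv : ∃ C : ℝ, ∀ k : ℤ, |(a k)⁻¹| ≤ C * (1 + (k : ℝ) ^ 2) ^ (-r / 2)
  smooth : ∀ q : ℝ, 3 / 2 < q → r ≤ q → SmoothConjugation a r q

/-- The Fourier coefficients of a product of two periodic distributions. -/
def conv (c d : ℤ → ℂ) (n : ℤ) : ℂ := ∑' m : ℤ, c (n - m) * d m

/-- The Fourier coefficients of the derivative of a periodic distribution. -/
def dx (c : ℤ → ℂ) (n : ℤ) : ℂ := Complex.I * n * c n

/-- The Fourier coefficients of the image of a periodic distribution under `op(a)`. -/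
def mult (a : ℤ → ℝ) (c : ℤ → ℂ) (n : ℤ) : ℂ := a n * c n

/-- The Fourier coefficients of `S(u) = A⁻¹ ([A, u] u_x - 2 (A u) u_x)`, where
`[A, u] u_x = A (u u_x) - u A u_x`, in terms of those of `u`. -/
def quadCoeff (a : ℤ → ℝ) (c : ℤ → ℂ) : ℤ → ℂ :=
  mult (fun n => (a n)⁻¹)
    (mult a (conv c (dx c)) - conv c (mult a (dx c)) - 2 • conv (mult a c) (dx c))

/-- `w = S_φ(v) = S(v ∘ φ⁻¹) ∘ φ`. -/
def IsAcceleration (a : ℤ → ℝ) {q : ℝ} (φ : D q) (v w : H q) : Prop :=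
  coeff (fun x => w (φ.toHomeo.symm x)) = quadCoeff a (coeff fun x => v (φ.toHomeo.symm x))

open Classical in
/-- `S_φ(v)` as an element of `H^q` (with the value `0` if it were not of class `H^q`). -/
def acceleration (a : ℤ → ℝ) {q : ℝ} (φ : D q) (v : H q) : H q :=
  if h : ∃ w : H q, IsAcceleration a φ v w then h.choose else 0

/-- The geodesic spray `F_q(φ, v) = (v, S_φ(v))`. -/
def spray (a : ℤ → ℝ) (q : ℝ) (p : D q × H q) : H q × H q := (p.2, acceleration a p.1 p.2)

/-- Bounded subsets of `D^q × H^q`, for the distance `d_q(φ₁, φ₂) + ‖v₁ - v₂‖`. -/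
def IsBoundedSet {q : ℝ} (B : Set (D q × H q)) : Prop :=
  ∃ C : ℝ, ∀ p ∈ B, ∀ p' ∈ B, dq p.1 p'.1 + ‖p.2 - p'.2‖ ≤ C

end SprayBounded

end

/-!
The spray is the conjugate `S_φ = R_φ ∘ S ∘ R_φ⁻¹` of the fixed quadratic map `S` by the composition
operators `R_φ v = v ∘ φ`. It is therefore enough to bound `S` on `H^q`, and to bound `R_φ` and
`R_φ⁻¹` on `H^q` uniformly on bounded subsets of `D^q`.

*The quadratic map.* The smoothness of `φ ↦ A_φ` enters at the identity. The derivative of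
`φ ↦ A_φ u` at the identity in the direction `u` is `u A u_x - A (u u_x) = -[A, u] u_x`
(`coeff_derivative_conjugate`): test `A_φ u ∘ φ⁻¹ = A (u ∘ φ⁻¹)` against `exp (-i n x)` for
`φ = id + t u`, remove `φ⁻¹` by a change of variables, and differentiate at `t = 0`. Hence `[A, u] u_x`
lies in `H^(q-r)` with a quadratic bound. So does `(A u) u_x`, since `H^(q-1)` acts on `H^(q-r)` by
multiplication (`exists_energy_mul_le`), and `A⁻¹` maps `H^(q-r)` to `H^q`
(`exists_quadCoeff_bound`).

*The composition operators.* On `H^σ` with `σ < 1` the Gagliardo seminorm shows that composition is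
controlled by upper and lower bounds on `φ_x` alone (`exists_energy_comp_le_of_lt_one`). An induction
on the integer part of `σ` based on `(u ∘ φ)_x = (u_x ∘ φ) φ_x` and
`(u ∘ φ⁻¹)_x = (u_x / φ_x) ∘ φ⁻¹` reaches `σ = q` (`exists_energy_comp_le`). It needs a bound on
`1 / φ_x` in `H^(q-1)` in terms of `‖φ_x‖` in `H^(q-1)` and `‖1 / φ_x‖_∞`, which is obtained in the
same way (`exists_energy_inv_le`). These two norms, and `‖φ_x‖_∞` by the Sobolev embedding, are
bounded on sets which are bounded for `d_q` (`exists_bounds_of_dq_le`).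

Sobolev norms are handled through their squares `energy σ u`, which take values in `[0, ∞]`, so that
sums and integrals may be interchanged freely.
-/

open scoped ENNReal

noncomputable section

namespace SprayBounded

/-! ### Sobolev energies -/

/-- The square of the `H^σ` norm, with value `⊤` off `H^σ`. -/
def energy (σ : ℝ) (u : T → ℝ) : ℝ≥0∞ :=
  ∑' n : ℤ, ENNReal.ofReal ((1 + (n : ℝ) ^ 2) ^ σ) * ‖coeff u n‖ₑ ^ 2

theorem weight_mul_enorm_sq (σ : ℝ) (z : ℂ) (n : ℤ) :
    ENNReal.ofReal ((1 + (n : ℝ) ^ 2) ^ σ) * ‖z‖ₑ ^ 2 =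
      ENNReal.ofReal ((1 + (n : ℝ) ^ 2) ^ σ * ‖z‖ ^ 2) := by
  rw [ENNReal.ofReal_mul (by positivity), ENNReal.ofReal_pow (norm_nonneg _), ofReal_norm]

theorem energy_eq_tsum_ofReal (σ : ℝ) (u : T → ℝ) :
    energy σ u = ∑' n : ℤ, ENNReal.ofReal ((1 + (n : ℝ) ^ 2) ^ σ * ‖coeff u n‖ ^ 2) :=
  tsum_congr fun n => weight_mul_enorm_sq σ _ n

theorem memSob_iff {σ : ℝ} {u : T → ℝ} : MemSob σ u ↔ MemLp u 2 haar ∧ energy σ u ≠ ⊤ := by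
  rw [MemSob, energy_eq_tsum_ofReal]
  refine and_congr_right fun _ => ⟨fun h => h.tsum_ofReal_ne_top, fun h => ?_⟩
  have h1 := ENNReal.summable_toReal h
  refine h1.congr fun n => ?_
  rw [ENNReal.toReal_ofReal (by positivity)]

theorem MemSob.ofReal_sobNorm_sq {σ : ℝ} {u : T → ℝ} (hu : MemSob σ u) :
    ENNReal.ofReal (sobNorm σ u ^ 2) = energy σ u := by
  rw [sobNorm, Real.sq_sqrt (tsum_nonneg fun n => by positivity), energy_eq_tsum_ofReal,
    ENNReal.ofReal_tsum_of_nonneg (fun n => by positivity) hu.2]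

theorem sobNorm_nonneg (σ : ℝ) (u : T → ℝ) : 0 ≤ sobNorm σ u := Real.sqrt_nonneg _

theorem energy_congr {σ : ℝ} {u v : T → ℝ} (h : u =ᵐ[haar] v) : energy σ u = energy σ v := by
  rw [energy, energy, coeff_congr h]

theorem memSob_congr {σ : ℝ} {u v : T → ℝ} (h : u =ᵐ[haar] v) (hu : MemSob σ u) :
    MemSob σ v := by
  rw [memSob_iff] at hu ⊢
  exact ⟨hu.1.ae_eq h, by rw [← energy_congr h]; exact hu.2⟩

theorem one_le_weight (n : ℤ) : (1 : ℝ) ≤ 1 + (n : ℝ) ^ 2 := by nlinarith [sq_nonneg (n : ℝ)]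

theorem energy_mono {σ τ : ℝ} (h : σ ≤ τ) (u : T → ℝ) : energy σ u ≤ energy τ u := by
  refine ENNReal.tsum_le_tsum fun n => ?_
  gcongr
  exact one_le_weight n

theorem MemSob.mono {σ τ : ℝ} (h : σ ≤ τ) {u : T → ℝ} (hu : MemSob τ u) : MemSob σ u := by
  rw [memSob_iff] at hu ⊢
  exact ⟨hu.1, ne_top_of_le_ne_top hu.2 (energy_mono h u)⟩

theorem sobolev_memSob {σ : ℝ} (u : H σ) : MemSob σ u := ⟨Lp.memLp u.1, u.2⟩

theorem ofReal_norm_sq {σ : ℝ} (u : H σ) : ENNReal.ofReal (‖u‖ ^ 2) = energy σ u := by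
  rw [norm_eq_sobNorm, (sobolev_memSob u).ofReal_sobNorm_sq]

theorem MemSob.exists_sobolev {σ : ℝ} {u : T → ℝ} (hu : MemSob σ u) :
    ∃ w : H σ, (w : T → ℝ) =ᵐ[haar] u := by
  have h := hu.1.coeFn_toLp
  exact ⟨⟨hu.1.toLp u, (memSob_congr h.symm hu).2⟩, h⟩

theorem sobolev_ext {σ : ℝ} {u v : H σ} (h : (u : T → ℝ) =ᵐ[haar] v) : u = v :=
  Subtype.ext (Lp.ext h)

/-! ### Fourier coefficients of square integrable functions -/

theorem hasSum_norm_sq_fourierCoeff {u : T → ℂ} (hu : MemLp u 2 haar) :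
    HasSum (fun n => ‖fourierCoeff u n‖ ^ 2) (∫ x, ‖u x‖ ^ 2 ∂haar) := by
  have h := hasSum_sq_fourierCoeff (hu.toLp u)
  have h1 : fourierCoeff (hu.toLp u) = fourierCoeff u := fourierCoeff_congr_ae hu.coeFn_toLp
  rw [h1] at h
  convert h using 1
  refine integral_congr_ae ?_
  filter_upwards [hu.coeFn_toLp] with x hx
  rw [hx]

/-- Parseval's identity. -/
theorem tsum_enorm_sq_fourierCoeff {u : T → ℂ} (hu : MemLp u 2 haar) :
    ∑' n, ‖fourierCoeff u n‖ₑ ^ 2 = ∫⁻ x, ‖u x‖ₑ ^ 2 ∂haar := by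
  have h := hasSum_norm_sq_fourierCoeff hu
  have hi : Integrable (fun x => ‖u x‖ ^ 2) haar :=
    (memLp_two_iff_integrable_sq_norm hu.1).1 hu
  have h2 := ofReal_integral_eq_lintegral_ofReal hi (Filter.Eventually.of_forall fun x => by positivity)
  have h3 : ∀ z : ℂ, ‖z‖ₑ ^ 2 = ENNReal.ofReal (‖z‖ ^ 2) := fun z => by
    rw [ENNReal.ofReal_pow (norm_nonneg _), ofReal_norm]
  simp only [h3]
  rw [← h2, ← h.tsum_eq, ENNReal.ofReal_tsum_of_nonneg (fun n => by positivity) h.summable]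

theorem enorm_ofReal (r : ℝ) : ‖(r : ℂ)‖ₑ = ‖r‖ₑ := by
  rw [← ofReal_norm, ← ofReal_norm, Complex.norm_real]

theorem energy_zero {u : T → ℝ} (hu : MemLp u 2 haar) :
    energy 0 u = ∫⁻ x, ‖u x‖ₑ ^ 2 ∂haar := by
  have h := tsum_enorm_sq_fourierCoeff (u := fun x => (u x : ℂ)) hu.ofReal
  simp only [enorm_ofReal] at h
  rw [← h, energy]
  refine tsum_congr fun n => ?_
  simp [coeff]

/-- The bilinear form of Parseval's identity: the coefficients of a product are the convolution. -/
theorem hasSum_fourierCoeff_mul {u v : T → ℂ} (hu : MemLp u 2 haar) (hv : MemLp v 2 haar) (n : ℤ) :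
    HasSum (fun m => fourierCoeff u (n - m) * fourierCoeff v m)
      (fourierCoeff (fun x => u x * v x) n) := by
  have hm : MemLp (fun x => (starRingEnd ℂ) (u x) * fourier n x) 2 haar := by
    have h1 : MemLp (fun x => (starRingEnd ℂ) (u x)) 2 haar := hu.star
    refine h1.mono (h1.1.mul (map_continuous (fourier n)).aestronglyMeasurable)
      (Filter.Eventually.of_forall fun x => ?_)
    rw [fourier_apply, norm_mul, Circle.norm_coe, mul_one]
  have h := fourierBasis.hasSum_inner_mul_inner (hm.toLp _) (hv.toLp _)
  have e1 : ∀ m, inner ℂ (hm.toLp _) (fourierBasis m) = fourierCoeff u (n - m) := fun m => by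
    have h1 := fourierBasis_repr (hm.toLp _) m
    rw [HilbertBasis.repr_apply_apply] at h1
    rw [← inner_conj_symm, h1, fourierCoeff_congr_ae hm.coeFn_toLp, fourierCoeff, fourierCoeff,
      ← integral_conj]
    refine integral_congr_ae (Filter.Eventually.of_forall fun x => ?_)
    simp only [smul_eq_mul, map_mul, Complex.conj_conj]
    rw [← fourier_neg, ← fourier_neg, neg_neg, show -(n - m) = m + -n by ring, fourier_add]
    ring
  have e2 : ∀ m, inner ℂ (fourierBasis m) (hv.toLp _) = fourierCoeff v m := fun m => by
    have h1 := fourierBasis_repr (hv.toLp _) m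
    rw [HilbertBasis.repr_apply_apply] at h1
    rw [h1, fourierCoeff_congr_ae hv.coeFn_toLp]
  have e3 : inner ℂ (hm.toLp _) (hv.toLp _) = fourierCoeff (fun x => u x * v x) n := by
    rw [L2.inner_def, fourierCoeff]
    refine integral_congr_ae ?_
    filter_upwards [hm.coeFn_toLp, hv.coeFn_toLp] with x hx hy
    rw [hx, hy]
    simp only [RCLike.inner_apply, smul_eq_mul, map_mul, Complex.conj_conj]
    rw [← fourier_neg]
    ring
  simp only [e1, e2, e3] at h
  exact h

theorem hasSum_coeff_mul {u v : T → ℝ} (hu : MemLp u 2 haar) (hv : MemLp v 2 haar) (n : ℤ) :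
    HasSum (fun m => coeff u (n - m) * coeff v m) (coeff (fun x => u x * v x) n) := by
  have h := hasSum_fourierCoeff_mul (u := fun x => (u x : ℂ)) (v := fun x => (v x : ℂ))
    hu.ofReal hv.ofReal n
  simpa [coeff] using h

theorem conv_coeff {u v : T → ℝ} (hu : MemLp u 2 haar) (hv : MemLp v 2 haar) :
    conv (coeff u) (coeff v) = coeff fun x => u x * v x :=
  funext fun n => (hasSum_coeff_mul hu hv n).tsum_eq

theorem ae_eq_of_coeff_eq {u v : T → ℝ} (hu : MemLp u 2 haar) (hv : MemLp v 2 haar)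
    (h : coeff u = coeff v) : u =ᵐ[haar] v := by
  have h1 : ∀ n, coeff (hu.toLp u - hv.toLp v : Lp ℝ 2 haar) n = 0 := fun n => by
    rw [sub_eq_add_neg, ← neg_one_smul ℝ, coeff_add, coeff_smul, coeff_congr hu.coeFn_toLp,
      coeff_congr hv.coeFn_toLp, h]
    simp
  have h2 := sub_eq_zero.1 (eq_zero_of_coeff _ h1)
  exact (MemLp.toLp_eq_toLp_iff hu hv).1 h2

theorem coeff_neg_index (u : T → ℝ) (n : ℤ) : coeff u (-n) = (starRingEnd ℂ) (coeff u n) := by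
  rw [coeff, coeff, fourierCoeff, fourierCoeff, ← integral_conj]
  refine integral_congr_ae (Filter.Eventually.of_forall fun x => ?_)
  simp only [smul_eq_mul, map_mul, Complex.conj_ofReal]
  rw [← fourier_neg]

/-- Riesz–Fischer for real functions. -/
theorem exists_coeff_eq {c : ℤ → ℂ} (hc : ∀ n, c (-n) = (starRingEnd ℂ) (c n))
    (hs : Summable fun n => ‖c n‖ ^ 2) : ∃ u : T → ℝ, MemLp u 2 haar ∧ coeff u = c := by
  have hm : Memℓp c 2 := memℓp_gen (by simpa using hs)
  set U : Lp ℂ 2 haar := fourierBasis.repr.symm ⟨c, hm⟩ with hU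
  have hUc : ∀ n, fourierCoeff U n = c n := fun n => by
    rw [← fourierBasis_repr, hU, LinearIsometryEquiv.apply_symm_apply]
  have hUm : MemLp (U : T → ℂ) 2 haar := Lp.memLp U
  refine ⟨fun x => (U x).re, hUm.re, ?_⟩
  funext n
  have hre : (fun x : T => (((U x).re : ℝ) : ℂ)) =
      fun x => (1 / 2 : ℂ) * (U x + (starRingEnd ℂ) (U x)) := by
    funext x
    rw [Complex.re_eq_add_conj]; ring
  have hi : Integrable (U : T → ℂ) haar := hUm.integrable (by norm_num)
  have hi' : Integrable (fun x => (starRingEnd ℂ) (U x)) haar := MemLp.integrable (q := 2) (by norm_num) hUm.star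
  rw [coeff, hre, fourierCoeff.const_mul]
  have hadd := congrFun (fourierCoeff.add hi hi') n
  have hadd' : fourierCoeff (fun x => U x + (starRingEnd ℂ) (U x)) n =
      fourierCoeff U n + fourierCoeff (fun x => (starRingEnd ℂ) (U x)) n := hadd
  have hcj : fourierCoeff (fun x => (starRingEnd ℂ) (U x)) n = (starRingEnd ℂ) (fourierCoeff U (-n)) := by
    rw [fourierCoeff, fourierCoeff, ← integral_conj]
    refine integral_congr_ae (Filter.Eventually.of_forall fun x => ?_)
    simp only [smul_eq_mul, map_mul]
    rw [neg_neg, ← fourier_neg]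
  rw [hadd', hcj, hUc, hUc, hc, Complex.conj_conj]
  ring

theorem coeff_add_fun {u v : T → ℝ} (hu : MemLp u 2 haar) (hv : MemLp v 2 haar) (n : ℤ) :
    coeff (fun x => u x + v x) n = coeff u n + coeff v n := by
  have h := congrFun (fourierCoeff.add (f := fun x => (u x : ℂ)) (g := fun x => (v x : ℂ))
    ((hu.integrable (by norm_num)).ofReal) ((hv.integrable (by norm_num)).ofReal)) n
  simp only [coeff, Complex.ofReal_add]
  exact h

theorem coeff_const_mul (c : ℝ) (u : T → ℝ) (n : ℤ) :
    coeff (fun x => c * u x) n = c * coeff u n := by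
  have h := fourierCoeff.const_mul (fun x => ((u x : ℝ) : ℂ)) (c : ℂ) n
  simp only [coeff, Complex.ofReal_mul]
  exact h

theorem energy_const_mul (σ c : ℝ) (u : T → ℝ) :
    energy σ (fun x => c * u x) = ENNReal.ofReal (c ^ 2) * energy σ u := by
  rw [energy, energy, ← ENNReal.tsum_mul_left]
  refine tsum_congr fun n => ?_
  rw [coeff_const_mul, enorm_mul, enorm_ofReal, mul_pow, Real.enorm_eq_ofReal_abs,
    ← ENNReal.ofReal_pow (abs_nonneg _), sq_abs]
  ring

theorem energy_add_le (σ : ℝ) {u v : T → ℝ} (hu : MemLp u 2 haar) (hv : MemLp v 2 haar) :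
    energy σ (fun x => u x + v x) ≤ 2 * (energy σ u + energy σ v) := by
  rw [energy, energy, energy, ← ENNReal.tsum_add, ← ENNReal.tsum_mul_left]
  refine ENNReal.tsum_le_tsum fun n => ?_
  rw [coeff_add_fun hu hv]
  have h1 : ‖coeff u n + coeff v n‖ₑ ^ 2 ≤ 2 * (‖coeff u n‖ₑ ^ 2 + ‖coeff v n‖ₑ ^ 2) := by
    have h3 : ∀ z : ℂ, ‖z‖ₑ ^ 2 = ENNReal.ofReal (‖z‖ ^ 2) := fun z => by
      rw [ENNReal.ofReal_pow (norm_nonneg _), ofReal_norm]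
    rw [h3, h3, h3, ← ENNReal.ofReal_add (by positivity) (by positivity),
      show (2 : ℝ≥0∞) = ENNReal.ofReal 2 by simp, ← ENNReal.ofReal_mul (by norm_num)]
    refine ENNReal.ofReal_le_ofReal ?_
    have h4 := pow_le_pow_left₀ (norm_nonneg _) (norm_add_le (coeff u n) (coeff v n)) 2
    nlinarith [sq_nonneg (‖coeff u n‖ - ‖coeff v n‖)]
  calc _ ≤ ENNReal.ofReal ((1 + (n : ℝ) ^ 2) ^ σ) * (2 * (‖coeff u n‖ₑ ^ 2 + ‖coeff v n‖ₑ ^ 2)) := by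
        gcongr
    _ = _ := by ring

theorem MemSob.add {σ : ℝ} {u v : T → ℝ} (hu : MemSob σ u) (hv : MemSob σ v) :
    MemSob σ fun x => u x + v x := by
  rw [memSob_iff] at *
  refine ⟨hu.1.add hv.1, ne_top_of_le_ne_top ?_ (energy_add_le σ hu.1 hv.1)⟩
  exact ENNReal.mul_ne_top (by norm_num) (ENNReal.add_ne_top.2 ⟨hu.2, hv.2⟩)

theorem MemSob.const_mul {σ : ℝ} {u : T → ℝ} (c : ℝ) (hu : MemSob σ u) :
    MemSob σ fun x => c * u x := by
  rw [memSob_iff] at *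
  refine ⟨hu.1.const_mul c, ?_⟩
  rw [energy_const_mul]
  exact ENNReal.mul_ne_top (by simp) hu.2

theorem memLp_of_continuous {u : T → ℝ} (hu : Continuous u) : MemLp u 2 haar :=
  hu.memLp_of_hasCompactSupport (HasCompactSupport.of_compactSpace u)

theorem coeff_const (c : ℝ) (n : ℤ) : coeff (fun _ => c) n = if n = 0 then (c : ℂ) else 0 := by
  have h := congrFun (fourierCoeff_fourier (T := 2 * Real.pi) 0) n
  have h1 := fourierCoeff.const_mul (fourier (T := 2 * Real.pi) 0) (c : ℂ) n
  have h2 : (fun x : T => (c : ℂ) * (fourier 0) x) = fun _ => (c : ℂ) := by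
    funext x; rw [fourier_zero, mul_one]
  rw [h2] at h1
  change fourierCoeff (fun _ : T => (c : ℂ)) n = _
  rw [h1, h]
  by_cases hn : n = 0 <;> simp [hn]

/-! ### Products -/

theorem tsum_mul_sq_le (a b : ℤ → ℝ≥0∞) :
    (∑' n, a n * b n) ^ 2 ≤ (∑' n, a n ^ 2) * ∑' n, b n ^ 2 := by
  have h := ENNReal.lintegral_mul_le_Lp_mul_Lq Measure.count Real.HolderConjugate.two_two
    (f := a) (g := b) (measurable_of_countable a).aemeasurable
    (measurable_of_countable b).aemeasurable
  simp only [lintegral_count, Pi.mul_apply] at h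
  have h2 := pow_le_pow_left' h 2
  refine h2.trans (le_of_eq ?_)
  rw [mul_pow, ← ENNReal.rpow_natCast, ← ENNReal.rpow_natCast, ← ENNReal.rpow_mul,
    ← ENNReal.rpow_mul]
  norm_num

/-- The weight `(1 + n²)^σ` of the Sobolev norm. -/
def wt (σ : ℝ) (n : ℤ) : ℝ≥0∞ := ENNReal.ofReal ((1 + (n : ℝ) ^ 2) ^ σ)

theorem energy_eq (σ : ℝ) (u : T → ℝ) : energy σ u = ∑' n, wt σ n * ‖coeff u n‖ₑ ^ 2 := rfl

theorem weight_pos (n : ℤ) : (0 : ℝ) < 1 + (n : ℝ) ^ 2 := by positivity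

theorem wt_mul (σ τ : ℝ) (n : ℤ) : wt σ n * wt τ n = wt (σ + τ) n := by
  rw [wt, wt, wt, ← ENNReal.ofReal_mul (by positivity), Real.rpow_add (weight_pos n)]

theorem wt_zero (n : ℤ) : wt 0 n = 1 := by simp [wt]

theorem wt_one (n : ℤ) : wt 1 n = 1 + ‖Complex.I * n‖ₑ ^ 2 := by
  rw [wt, Real.rpow_one, ENNReal.ofReal_add (by norm_num) (by positivity), ← ofReal_norm,
    ← ENNReal.ofReal_pow (norm_nonneg _)]
  simp

theorem tsum_wt_ne_top {τ : ℝ} (hτ : 1 / 2 < τ) : ∑' n, wt (-τ) n ≠ ⊤ := by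
  have h1 : Summable fun n : ℤ => |(n : ℝ)| ^ (-(2 * τ)) :=
    Real.summable_abs_int_rpow (by linarith)
  have h2 : Summable fun n : ℤ => (1 + (n : ℝ) ^ 2) ^ (-τ) := by
    refine Summable.of_norm_bounded_eventually h1 ?_
    rw [Filter.eventually_cofinite]
    refine (Set.finite_singleton (0 : ℤ)).subset fun n hn => ?_
    by_contra h0
    refine hn ?_
    have h3 : (0 : ℝ) < |(n : ℝ)| := abs_pos.2 (by exact_mod_cast h0)
    rw [Real.norm_of_nonneg (by positivity), ← mul_neg, Real.rpow_mul h3.le]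
    refine Real.rpow_le_rpow_of_nonpos (by positivity) ?_ (by linarith)
    rw [Real.rpow_two, sq_abs]; linarith
  exact h2.tsum_ofReal_ne_top

/-- Peetre's inequality, in the form which makes `H^τ` a multiplier algebra of `H^σ`. -/
theorem weight_le {σ τ : ℝ} (h0 : 0 ≤ σ) (h : σ ≤ τ) (n m : ℤ) :
    wt σ n * (wt (-σ) (n - m) * wt (-τ) m) ≤
      ENNReal.ofReal (4 ^ σ) * (wt (-τ) m + wt (-τ) (n - m)) := by
  simp only [wt]
  rw [← ENNReal.ofReal_mul (by positivity), ← ENNReal.ofReal_mul (by positivity),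
    ← ENNReal.ofReal_add (by positivity) (by positivity), ← ENNReal.ofReal_mul (by positivity)]
  refine ENNReal.ofReal_le_ofReal ?_
  set a : ℝ := 1 + ((n - m : ℤ) : ℝ) ^ 2 with ha
  set b : ℝ := 1 + (m : ℝ) ^ 2 with hb
  have ha0 : 0 < a := weight_pos _
  have hb0 : 0 < b := weight_pos _
  have hn : 1 + (n : ℝ) ^ 2 ≤ 2 * a + 2 * b := by
    rw [ha, hb]; push_cast
    nlinarith [sq_nonneg ((n : ℝ) - m - m)]
  have hX : ∀ z : ℝ, 0 < z → z ^ σ * z ^ (-σ) = 1 := fun z hz => by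
    rw [← Real.rpow_add hz]; simp
  rcases le_total b a with hab | hab
  · have h1 : (1 + (n : ℝ) ^ 2) ^ σ ≤ 4 ^ σ * a ^ σ := by
      rw [← Real.mul_rpow (by norm_num) ha0.le]
      exact Real.rpow_le_rpow (by positivity) (by linarith) h0
    calc (1 + (n : ℝ) ^ 2) ^ σ * (a ^ (-σ) * b ^ (-τ))
        ≤ 4 ^ σ * a ^ σ * (a ^ (-σ) * b ^ (-τ)) := by gcongr
      _ = 4 ^ σ * b ^ (-τ) := by rw [← mul_assoc, mul_assoc (4 ^ σ) (a ^ σ), hX a ha0, mul_one]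
      _ ≤ _ := by gcongr; linarith [Real.rpow_pos_of_pos ha0 (-τ)]
  · have h1 : (1 + (n : ℝ) ^ 2) ^ σ ≤ 4 ^ σ * b ^ σ := by
      rw [← Real.mul_rpow (by norm_num) hb0.le]
      exact Real.rpow_le_rpow (by positivity) (by linarith) h0
    have h2 : b ^ (σ - τ) ≤ a ^ (σ - τ) := Real.rpow_le_rpow_of_nonpos ha0 hab (by linarith)
    calc (1 + (n : ℝ) ^ 2) ^ σ * (a ^ (-σ) * b ^ (-τ))
        ≤ 4 ^ σ * b ^ σ * (a ^ (-σ) * b ^ (-τ)) := by gcongr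
      _ = 4 ^ σ * (a ^ (-σ) * b ^ (σ - τ)) := by
          rw [sub_eq_add_neg, Real.rpow_add hb0]; ring
      _ ≤ 4 ^ σ * (a ^ (-σ) * a ^ (σ - τ)) := by gcongr
      _ = 4 ^ σ * a ^ (-τ) := by rw [← Real.rpow_add ha0]; ring_nf
      _ ≤ _ := by gcongr; linarith [Real.rpow_pos_of_pos hb0 (-τ)]

theorem wt_half_sq (σ : ℝ) (n : ℤ) : wt (σ / 2) n ^ 2 = wt σ n := by
  rw [sq, wt_mul]; ring_nf

/-- `H^τ` acts on `H^σ` by multiplication for `0 ≤ σ ≤ τ` and `τ > 1/2`. -/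
theorem exists_energy_mul_le {σ τ : ℝ} (h0 : 0 ≤ σ) (h : σ ≤ τ) (hτ : 1 / 2 < τ) :
    ∃ K : ℝ≥0∞, K ≠ ⊤ ∧ ∀ u v : T → ℝ, MemLp u 2 haar → MemLp v 2 haar →
      energy σ (fun x => u x * v x) ≤ K * (energy σ u * energy τ v) := by
  set Λ := ∑' n, wt (-τ) n with hΛ
  refine ⟨ENNReal.ofReal (4 ^ σ) * (Λ + Λ), ?_, fun u v hu hv => ?_⟩
  · exact ENNReal.mul_ne_top (by simp) (ENNReal.add_ne_top.2 ⟨tsum_wt_ne_top hτ, tsum_wt_ne_top hτ⟩)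
  set X : ℤ → ℝ≥0∞ := fun n => wt σ n * ‖coeff u n‖ₑ ^ 2 with hX
  set Y : ℤ → ℝ≥0∞ := fun n => wt τ n * ‖coeff v n‖ₑ ^ 2 with hY
  -- Cauchy–Schwarz with the weights split off: their sum over `m` is bounded uniformly in `n`.
  have key : ∀ n, wt σ n * ‖coeff (fun x => u x * v x) n‖ₑ ^ 2 ≤
      ENNReal.ofReal (4 ^ σ) * (Λ + Λ) * ∑' m, X (n - m) * Y m := fun n => by
    have h1 : ‖coeff (fun x => u x * v x) n‖ₑ ≤ ∑' m, (wt (-σ / 2) (n - m) * wt (-τ / 2) m) *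
        (wt (σ / 2) (n - m) * ‖coeff u (n - m)‖ₑ * (wt (τ / 2) m * ‖coeff v m‖ₑ)) := by
      rw [← (hasSum_coeff_mul hu hv n).tsum_eq]
      refine enorm_tsum_le_tsum_enorm.trans (le_of_eq (tsum_congr fun m => ?_))
      have e1 : wt (-σ / 2) (n - m) * wt (σ / 2) (n - m) = 1 := by
        rw [wt_mul, show -σ / 2 + σ / 2 = 0 by ring, wt_zero]
      have e2 : wt (-τ / 2) m * wt (τ / 2) m = 1 := by
        rw [wt_mul, show -τ / 2 + τ / 2 = 0 by ring, wt_zero]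
      calc ‖coeff u (n - m) * coeff v m‖ₑ = (wt (-σ / 2) (n - m) * wt (σ / 2) (n - m)) *
            (wt (-τ / 2) m * wt (τ / 2) m) * (‖coeff u (n - m)‖ₑ * ‖coeff v m‖ₑ) := by
            rw [e1, e2, enorm_mul]; ring
        _ = _ := by ring
    have h2 := (pow_le_pow_left' h1 2).trans (tsum_mul_sq_le _ _)
    have h3 : ∑' m, (wt (σ / 2) (n - m) * ‖coeff u (n - m)‖ₑ * (wt (τ / 2) m * ‖coeff v m‖ₑ)) ^ 2 =
        ∑' m, X (n - m) * Y m := tsum_congr fun m => by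
      rw [hX, hY]; simp only [mul_pow, wt_half_sq]
    have h4 : wt σ n * ∑' m, (wt (-σ / 2) (n - m) * wt (-τ / 2) m) ^ 2 ≤
        ENNReal.ofReal (4 ^ σ) * (Λ + Λ) := by
      rw [← ENNReal.tsum_mul_left]
      calc _ ≤ ∑' m, ENNReal.ofReal (4 ^ σ) * (wt (-τ) m + wt (-τ) (n - m)) := by
            refine ENNReal.tsum_le_tsum fun m => ?_
            rw [mul_pow, wt_half_sq, wt_half_sq]
            exact weight_le h0 h n m
        _ = _ := by
            rw [ENNReal.tsum_mul_left, ENNReal.tsum_add]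
            congr 2
            exact (Equiv.subLeft n).tsum_eq (wt (-τ))
    calc _ ≤ wt σ n * ((∑' m, (wt (-σ / 2) (n - m) * wt (-τ / 2) m) ^ 2) *
          ∑' m, X (n - m) * Y m) := by rw [← h3]; gcongr
      _ ≤ _ := by rw [← mul_assoc]; gcongr
  calc energy σ (fun x => u x * v x)
      ≤ ∑' n, ENNReal.ofReal (4 ^ σ) * (Λ + Λ) * ∑' m, X (n - m) * Y m :=
        ENNReal.tsum_le_tsum key
    _ = ENNReal.ofReal (4 ^ σ) * (Λ + Λ) * ((∑' n, X n) * ∑' m, Y m) := by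
        rw [ENNReal.tsum_mul_left, ENNReal.tsum_comm]
        congr 1
        rw [← ENNReal.tsum_mul_left]
        refine tsum_congr fun m => ?_
        rw [ENNReal.tsum_mul_right]
        congr 1
        exact (Equiv.subRight m).tsum_eq X
    _ = _ := rfl

/-- The Sobolev embedding of `H^τ`, `τ > 1/2`, at the level of Fourier coefficients. -/
theorem tsum_enorm_coeff_sq_le (τ : ℝ) (u : T → ℝ) :
    (∑' n, ‖coeff u n‖ₑ) ^ 2 ≤ (∑' n, wt (-τ) n) * energy τ u := by
  have h := tsum_mul_sq_le (wt (-τ / 2)) fun n => wt (τ / 2) n * ‖coeff u n‖ₑ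
  have e : ∀ n, wt (-τ / 2) n * (wt (τ / 2) n * ‖coeff u n‖ₑ) = ‖coeff u n‖ₑ := fun n => by
    rw [← mul_assoc, wt_mul, show -τ / 2 + τ / 2 = 0 by ring, wt_zero, one_mul]
  simp only [e, mul_pow, wt_half_sq] at h
  exact h

/-! ### Derivatives and the Sobolev embedding -/

theorem exists_continuous_of_summable {u : T → ℝ} (hu : MemLp u 2 haar)
    (hs : Summable fun n => ‖coeff u n‖) :
    ∃ g : T → ℝ, Continuous g ∧ g =ᵐ[haar] u ∧
      ∀ x, HasSum (fun n => coeff u n * fourier n x) (g x : ℂ) := by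
  have hU : MemLp (fun x => (u x : ℂ)) 2 haar := hu.ofReal
  have hsum : Summable fun n => coeff u n • (fourier n : C(T, ℂ)) := by
    refine Summable.of_norm ?_
    simpa only [norm_smul, fourier_norm, mul_one] using hs
  obtain ⟨G, hG⟩ := hsum
  have hx : ∀ x, HasSum (fun n => coeff u n * fourier n x) (G x) := fun x => by
    have := (ContinuousMap.evalCLM ℂ x).hasSum hG
    simpa using this
  have h1 := hasSum_fourier_series_L2 (hU.toLp _)
  have h2 := (ContinuousMap.toLp (E := ℂ) 2 (haar : Measure T) ℂ).hasSum hG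
  have h3 : (ContinuousMap.toLp (E := ℂ) 2 (haar : Measure T) ℂ) G = hU.toLp _ := by
    refine HasSum.unique h2 ?_
    convert h1 using 2 with n
    rw [fourierCoeff_congr_ae hU.coeFn_toLp, map_smul]
    rfl
  have h4 : (G : T → ℂ) =ᵐ[haar] fun x => (u x : ℂ) :=
    (ContinuousMap.coeFn_toLp (p := 2) (𝕜 := ℂ) haar G).symm.trans
      ((Filter.EventuallyEq.of_eq (by rw [h3])).trans hU.coeFn_toLp)
  have h5 : (fun x => (G x).im) = fun _ => 0 := by
    refine (Continuous.ae_eq_iff_eq haar (Complex.continuous_im.comp G.continuous)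
      continuous_const).1 ?_
    filter_upwards [h4] with x hx
    simp [hx]
  refine ⟨fun x => (G x).re, Complex.continuous_re.comp G.continuous, ?_, fun x => ?_⟩
  · filter_upwards [h4] with x hx
    simp [hx]
  · have h6 : (((G x).re : ℝ) : ℂ) = G x := by
      refine Complex.ext (by simp) ?_
      simpa using (congrFun h5 x).symm
    rw [h6]; exact hx x

theorem MemSob.summable_norm_coeff {τ : ℝ} (hτ : 1 / 2 < τ) {u : T → ℝ} (hu : MemSob τ u) :
    Summable fun n => ‖coeff u n‖ := by
  have h := tsum_enorm_coeff_sq_le τ u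
  have h1 : (∑' n, ‖coeff u n‖ₑ) ^ 2 ≠ ⊤ :=
    ne_top_of_le_ne_top (ENNReal.mul_ne_top (tsum_wt_ne_top hτ) (memSob_iff.1 hu).2) h
  have h2 : ∑' n, ‖coeff u n‖ₑ ≠ ⊤ := fun h3 => h1 (by rw [h3]; simp)
  simpa using ENNReal.summable_toReal h2

theorem MemSob.exists_continuous {τ : ℝ} (hτ : 1 / 2 < τ) {u : T → ℝ} (hu : MemSob τ u) :
    ∃ g : T → ℝ, Continuous g ∧ g =ᵐ[haar] u ∧
      ∀ x, HasSum (fun n => coeff u n * fourier n x) (g x : ℂ) :=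
  exists_continuous_of_summable hu.1 (hu.summable_norm_coeff hτ)

/-- The sup norm bound in the Sobolev embedding. -/
theorem MemSob.enorm_sq_le {τ : ℝ} (hτ : 1 / 2 < τ) {f : T → ℝ} (hf : MemSob τ f)
    (hc : Continuous f) (x : T) : ‖f x‖ₑ ^ 2 ≤ (∑' n, wt (-τ) n) * energy τ f := by
  obtain ⟨g, hg, hgf, hs⟩ := hf.exists_continuous hτ
  have h1 : g = f := (Continuous.ae_eq_iff_eq haar hg hc).1 hgf
  subst h1
  refine (pow_le_pow_left' ?_ 2).trans (tsum_enorm_coeff_sq_le τ g)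
  rw [← enorm_ofReal, ← (hs x).tsum_eq]
  refine enorm_tsum_le_tsum_enorm.trans (le_of_eq (tsum_congr fun n => ?_))
  have : ‖(fourier n x : ℂ)‖ₑ = 1 := by
    rw [← ofReal_norm, fourier_apply, Circle.norm_coe]; simp
  rw [enorm_mul, this, mul_one]

/-- `v` is the distributional derivative of `u`, where both functions are square integrable. -/
structure IsWeakDeriv (u v : T → ℝ) : Prop where
  memLp : MemLp u 2 haar
  memLp_deriv : MemLp v 2 haar
  coeff_eq : coeff v = dx (coeff u)

theorem energy_of_coeff_eq_dx {u v : T → ℝ} (h : coeff v = dx (coeff u)) (σ : ℝ) :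
    energy σ u = energy (σ - 1) u + energy (σ - 1) v := by
  rw [energy_eq, energy_eq, energy_eq, ← ENNReal.tsum_add]
  refine tsum_congr fun n => ?_
  rw [h, dx, enorm_mul, mul_pow, show σ = (σ - 1) + 1 by ring, ← wt_mul, wt_one]
  ring_nf

theorem IsWeakDeriv.memSob_deriv {u v : T → ℝ} (h : IsWeakDeriv u v) {σ : ℝ} (hu : MemSob σ u) :
    MemSob (σ - 1) v := by
  rw [memSob_iff] at *
  refine ⟨h.memLp_deriv, ne_top_of_le_ne_top hu.2 ?_⟩
  rw [energy_of_coeff_eq_dx h.coeff_eq σ]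
  exact le_add_self

theorem MemSob.exists_isWeakDeriv {σ : ℝ} (hσ : 1 ≤ σ) {u : T → ℝ} (hu : MemSob σ u) :
    ∃ v, IsWeakDeriv u v ∧ MemSob (σ - 1) v := by
  have h1 : Summable fun n => ‖dx (coeff u) n‖ ^ 2 := by
    refine Summable.of_nonneg_of_le (fun n => by positivity) (fun n => ?_) (hu.mono hσ).2
    rw [dx, Real.rpow_one, norm_mul, norm_mul, Complex.norm_I, one_mul, mul_pow,
      Complex.norm_intCast, sq_abs]
    gcongr
    linarith
  obtain ⟨v, hv, hc⟩ := exists_coeff_eq (c := dx (coeff u)) (fun n => by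
    rw [dx, dx, coeff_neg_index]; simp) h1
  have h : IsWeakDeriv u v := ⟨hu.1, hv, hc⟩
  exact ⟨v, h, h.memSob_deriv hu⟩

theorem hasDerivAt_fourier_circle (n : ℤ) (t : ℝ) :
    HasDerivAt (fun s : ℝ => (fourier n (s : T) : ℂ)) (Complex.I * n * fourier n (t : T)) t := by
  have h := hasDerivAt_fourier (2 * Real.pi) n t
  convert h using 1
  have : (Real.pi : ℂ) ≠ 0 := by exact_mod_cast Real.pi_ne_zero
  push_cast
  field_simp

/-- `f` is a `C¹` function on the circle with derivative `f'`. -/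
structure IsC1 {E : Type*} [NormedAddCommGroup E] [NormedSpace ℝ E] (f f' : T → E) : Prop where
  hasDerivAt : ∀ t : ℝ, HasDerivAt (fun s : ℝ => f (s : T)) (f' (t : T)) t
  continuous_deriv : Continuous f'

theorem continuous_of_comp_coe {E : Type*} [TopologicalSpace E] {f : T → E}
    (h : Continuous fun t : ℝ => f (t : T)) : Continuous f :=
  (QuotientAddGroup.isQuotientMap_mk (N := AddSubgroup.zmultiples (2 * Real.pi))).continuous_iff.2 h

theorem IsC1.continuous {E : Type*} [NormedAddCommGroup E] [NormedSpace ℝ E] {f f' : T → E}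
    (h : IsC1 f f') : Continuous f :=
  continuous_of_comp_coe
    (continuous_iff_continuousAt.2 fun t => (h.hasDerivAt t).continuousAt)

theorem IsC1.fourierCoeff_deriv {f f' : T → ℂ} (h : IsC1 f f') (n : ℤ) :
    fourierCoeff f' n = Complex.I * n * fourierCoeff f n := by
  have hc := h.continuous
  have h1 : ∀ t : ℝ, HasDerivAt (fun s : ℝ => fourier (-n) (s : T) * f (s : T))
      (Complex.I * (-n : ℤ) * fourier (-n) (t : T) * f (t : T) + fourier (-n) (t : T) * f' (t : T)) t :=
    fun t => (hasDerivAt_fourier_circle (-n) t).mul (h.hasDerivAt t)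
  have hcoe : Continuous fun t : ℝ => (t : T) := AddCircle.continuous_mk' _
  have c1 : Continuous fun t : ℝ => fourier (-n) (t : T) * f (t : T) :=
    ((map_continuous (fourier (-n))).comp hcoe).mul (hc.comp hcoe)
  have c2 : Continuous fun t : ℝ => fourier (-n) (t : T) * f' (t : T) :=
    ((map_continuous (fourier (-n))).comp hcoe).mul (h.continuous_deriv.comp hcoe)
  have h2 := intervalIntegral.integral_eq_sub_of_hasDerivAt (a := 0) (b := 2 * Real.pi)
    (fun t _ => h1 t) (by
      refine Continuous.intervalIntegrable ?_ _ _
      refine Continuous.add ?_ c2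
      simp only [mul_assoc]
      exact continuous_const.mul (continuous_const.mul c1))
  have h3 : ((2 * Real.pi : ℝ) : T) = ((0 : ℝ) : T) := by rw [AddCircle.coe_period, AddCircle.coe_zero]
  rw [h3, sub_self] at h2
  simp only [mul_assoc] at h2
  have c3 : Continuous fun t : ℝ => Complex.I * (((-n : ℤ) : ℂ) * (fourier (-n) (t : T) * f (t : T))) :=
    continuous_const.mul (continuous_const.mul c1)
  rw [intervalIntegral.integral_add (c3.intervalIntegrable _ _) (c2.intervalIntegrable _ _), intervalIntegral.integral_const_mul,
    intervalIntegral.integral_const_mul] at h2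
  rw [fourierCoeff_eq_intervalIntegral _ _ 0, fourierCoeff_eq_intervalIntegral _ _ 0, zero_add]
  simp only [smul_eq_mul]
  have h4 : (∫ t in (0 : ℝ)..2 * Real.pi, fourier (-n) (t : T) * f' (t : T)) =
      Complex.I * n * ∫ t in (0 : ℝ)..2 * Real.pi, fourier (-n) (t : T) * f (t : T) := by
    push_cast at h2
    linear_combination h2
  rw [h4, mul_smul_comm]

theorem IsC1.isWeakDeriv {f f' : T → ℝ} (h : IsC1 f f') : IsWeakDeriv f f' := by
  refine ⟨memLp_of_continuous h.continuous, memLp_of_continuous h.continuous_deriv, ?_⟩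
  funext n
  have h1 : IsC1 (fun x => (f x : ℂ)) fun x => (f' x : ℂ) :=
    ⟨fun t => (h.hasDerivAt t).ofReal_comp, Complex.continuous_ofReal.comp h.continuous_deriv⟩
  exact h1.fourierCoeff_deriv n

/-- The embedding `H^q ⊂ C¹` for `q > 3/2`. -/
theorem MemSob.exists_isC1 {q : ℝ} (hq : 3 / 2 < q) {u : T → ℝ} (hu : MemSob q u) :
    ∃ f f' : T → ℝ, IsC1 f f' ∧ f =ᵐ[haar] u ∧ MemSob (q - 1) f' := by
  obtain ⟨v, hv, hvs⟩ := hu.exists_isWeakDeriv (by linarith)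
  obtain ⟨f, hf, hfu, hfs⟩ := hu.exists_continuous (by linarith)
  obtain ⟨f', hf', hfv, hfs'⟩ := hvs.exists_continuous (by linarith)
  refine ⟨f, f', ⟨fun t => ?_, hf'⟩, hfu, memSob_congr hfv.symm hvs⟩
  have h1 := hasDerivAt_tsum (hvs.summable_norm_coeff (by linarith))
    (g := fun n (t : ℝ) => coeff u n * fourier n (t : T))
    (g' := fun n t => coeff v n * fourier n (t : T)) (y₀ := 0)
    (fun n t => by
      have := (hasDerivAt_fourier_circle n t).const_mul (coeff u n)
      rw [show coeff u n * (Complex.I * n * fourier n (t : T)) = coeff v n * fourier n (t : T) by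
        rw [hv.coeff_eq, dx]; ring] at this
      exact this)
    (fun n t => by rw [fourier_apply, norm_mul, Circle.norm_coe, mul_one])
    (hfs _).summable t
  simp only [(hfs _).tsum_eq, (hfs' _).tsum_eq] at h1
  exact Complex.reCLM.hasFDerivAt.comp_hasDerivAt t h1

/-! ### Diffeomorphisms of the circle -/

theorem exists_coe_abs_eq (x : T) : ∃ h : ℝ, (h : T) = x ∧ |h| = ‖x‖ := by
  obtain ⟨t, rfl⟩ := QuotientAddGroup.mk_surjective x
  refine ⟨t - round ((2 * Real.pi)⁻¹ * t) * (2 * Real.pi), ?_, (AddCircle.norm_eq _).symm⟩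
  have : ((round ((2 * Real.pi)⁻¹ * t) * (2 * Real.pi) : ℝ) : T) = 0 :=
    AddCircle.coe_eq_zero_iff _ |>.2 ⟨round ((2 * Real.pi)⁻¹ * t), by simp⟩
  rw [AddCircle.coe_sub, this, sub_zero]

theorem norm_coe_le_abs (h : ℝ) : ‖(h : T)‖ ≤ |h| := QuotientAddGroup.norm_mk_le_norm

theorem exists_bound_of_continuous {f : T → ℝ} (hf : Continuous f) : ∃ M, ∀ x, |f x| ≤ M := by
  obtain ⟨M, hM⟩ := isCompact_univ.exists_bound_of_continuousOn hf.continuousOn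
  exact ⟨M, fun x => hM x trivial⟩

/-- An orientation preserving `C¹` diffeomorphism of the circle, with its inverse and the
displacement `disp` of a lift `t ↦ t + disp t`. The inverse is part of the data so that it can be
matched definitionally with the inverse of a given homeomorphism. -/
structure CircleDiffeo where
  toFun : T → T
  inv : T → T
  disp : T → ℝ
  disp' : T → ℝ
  isC1 : IsC1 disp disp'
  pos : ∀ x, 0 < 1 + disp' x
  apply_eq : ∀ x, toFun x = x + (disp x : T)
  left_inv : ∀ x, inv (toFun x) = x
  right_inv : ∀ x, toFun (inv x) = x

theorem lift_strictMono {f f' : T → ℝ} (h : IsC1 f f') (hpos : ∀ x, 0 < 1 + f' x) :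
    StrictMono fun t : ℝ => t + f (t : T) := by
  refine strictMono_of_deriv_pos fun t => ?_
  have h1 := (hasDerivAt_id t).add (h.hasDerivAt t)
  have h2 : _root_.deriv (fun t : ℝ => t + f (t : T)) t = 1 + f' t := h1.deriv
  rw [h2]
  exact hpos _

theorem lift_surjective {f : T → ℝ} (h : Continuous f) :
    Function.Surjective fun t : ℝ => t + f (t : T) := by
  obtain ⟨M, hM⟩ := exists_bound_of_continuous h
  refine Continuous.surjective ?_ ?_ ?_
  · exact continuous_id.add (h.comp (AddCircle.continuous_mk' _))
  · exact Filter.tendsto_atTop_mono (fun t => by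
      simp only [id]; linarith [neg_abs_le (f t), hM t])
      (Filter.tendsto_atTop_add_const_right _ (-M) Filter.tendsto_id)
  · exact Filter.tendsto_atBot_mono (fun t => by
      simp only [id]; linarith [le_abs_self (f t), hM t])
      (Filter.tendsto_atBot_add_const_right _ M Filter.tendsto_id)

theorem exists_circleDiffeo {f f' : T → ℝ} (h : IsC1 f f') (hpos : ∀ x, 0 < 1 + f' x) :
    ∃ φ : CircleDiffeo, φ.disp = f ∧ φ.disp' = f' := by
  have hF := lift_strictMono h hpos
  have hS := lift_surjective h.continuous
  have hb : Function.Bijective fun x : T => x + (f x : T) := by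
    constructor
    · intro x y hxy
      obtain ⟨s, rfl⟩ := QuotientAddGroup.mk_surjective x
      obtain ⟨t, rfl⟩ := QuotientAddGroup.mk_surjective y
      have h1 : ((s + f (s : T) : ℝ) : T) = ((t + f (t : T) : ℝ) : T) := by
        rw [AddCircle.coe_add, AddCircle.coe_add]; exact hxy
      rw [← sub_eq_zero, ← AddCircle.coe_sub, AddCircle.coe_eq_zero_iff] at h1
      obtain ⟨k, hk⟩ := h1
      have h2 : ((t + k • (2 * Real.pi) : ℝ) : T) = (t : T) := by
        rw [AddCircle.coe_add, (AddCircle.coe_eq_zero_iff _).2 ⟨k, rfl⟩, add_zero]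
      have h3 : s = t + k • (2 * Real.pi) := by
        apply hF.injective
        simp only
        rw [h2, hk]; ring
      have h4 : (s : T) = (t : T) := by rw [h3]; exact h2
      exact h4
    · intro y
      obtain ⟨t, rfl⟩ := QuotientAddGroup.mk_surjective y
      obtain ⟨s, hs⟩ := hS t
      refine ⟨(s : T), ?_⟩
      simp only
      rw [← AddCircle.coe_add]
      simp only at hs
      rw [hs]
  let e := Equiv.ofBijective _ hb
  exact ⟨⟨e, e.symm, f, f', h, hpos, fun x => rfl, e.symm_apply_apply, e.apply_symm_apply⟩, rfl, rfl⟩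

namespace CircleDiffeo

variable (φ : CircleDiffeo)

/-- The derivative of a diffeomorphism of the circle. -/
def jac (x : T) : ℝ := 1 + φ.disp' x

theorem jac_pos (x : T) : 0 < φ.jac x := φ.pos x

theorem continuous_jac : Continuous φ.jac := continuous_const.add φ.isC1.continuous_deriv

/-- The lift of a diffeomorphism of the circle to the real line. -/
def lift : ℝ ≃o ℝ :=
  (lift_strictMono φ.isC1 φ.pos).orderIsoOfSurjective _ (lift_surjective φ.isC1.continuous)

theorem lift_apply (t : ℝ) : φ.lift t = t + φ.disp t := rfl

theorem coe_lift (t : ℝ) : ((φ.lift t : ℝ) : T) = φ.toFun t := by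
  rw [lift_apply, AddCircle.coe_add, φ.apply_eq]

theorem hasDerivAt_lift (t : ℝ) : HasDerivAt φ.lift (φ.jac t) t :=
  (hasDerivAt_id t).add (φ.isC1.hasDerivAt t)

theorem lift_add_period (t : ℝ) : φ.lift (t + 2 * Real.pi) = φ.lift t + 2 * Real.pi := by
  rw [lift_apply, lift_apply, AddCircle.coe_add_period]; ring

theorem coe_lift_symm (t : ℝ) : ((φ.lift.symm t : ℝ) : T) = φ.inv t := by
  rw [← φ.left_inv ((φ.lift.symm t : ℝ) : T), ← coe_lift, OrderIso.apply_symm_apply]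

theorem hasDerivAt_lift_symm (t : ℝ) :
    HasDerivAt φ.lift.symm (φ.jac (φ.inv t))⁻¹ t := by
  rw [← coe_lift_symm]
  exact HasDerivAt.of_local_left_inverse φ.lift.symm.continuous.continuousAt
    (φ.hasDerivAt_lift _) (φ.jac_pos _).ne' (Filter.Eventually.of_forall φ.lift.apply_symm_apply)

theorem continuous_toFun : Continuous φ.toFun := by
  rw [show φ.toFun = fun x => x + (φ.disp x : T) from funext φ.apply_eq]
  exact continuous_id.add ((AddCircle.continuous_mk' _).comp φ.isC1.continuous)

theorem continuous_inv : Continuous φ.inv := by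
  refine continuous_of_comp_coe ?_
  simp only [← coe_lift_symm]
  exact (AddCircle.continuous_mk' _).comp φ.lift.symm.continuous

/-- The inverse diffeomorphism. -/
def symm : CircleDiffeo where
  toFun := φ.inv
  inv := φ.toFun
  disp x := -φ.disp (φ.inv x)
  disp' x := (φ.jac (φ.inv x))⁻¹ - 1
  isC1 := by
    refine ⟨fun t => ?_, ?_⟩
    · have h := (φ.hasDerivAt_lift_symm t).sub (hasDerivAt_id t)
      have e : ((fun s => φ.lift.symm s) - id : ℝ → ℝ) = fun s : ℝ => -φ.disp (φ.inv s) := by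
        funext s
        have h1 := φ.lift.apply_symm_apply s
        rw [lift_apply, coe_lift_symm] at h1
        simp only [Pi.sub_apply, id]
        linarith
      rw [e] at h
      exact h
    · exact ((φ.continuous_jac.comp φ.continuous_inv).inv₀ fun x => (φ.jac_pos _).ne').sub
        continuous_const
  pos x := by
    have := inv_pos.2 (φ.jac_pos (φ.inv x))
    linarith
  apply_eq x := by
    have h := φ.apply_eq (φ.inv x)
    rw [φ.right_inv] at h
    rw [AddCircle.coe_neg, ← sub_eq_add_neg]
    exact eq_sub_of_add_eq h.symm
  left_inv := φ.right_inv
  right_inv := φ.left_inv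

theorem jac_symm (x : T) : φ.symm.jac x = (φ.jac (φ.inv x))⁻¹ := by
  simp [jac, symm]

/-- The homeomorphism of the circle underlying a diffeomorphism. -/
def homeo : T ≃ₜ T where
  toFun := φ.toFun
  invFun := φ.inv
  left_inv := φ.left_inv
  right_inv := φ.right_inv
  continuous_toFun := φ.continuous_toFun
  continuous_invFun := φ.continuous_inv

theorem isDisplacement : IsDisplacement φ.homeo φ.disp :=
  ⟨φ.isC1.continuous, lift_strictMono φ.isC1 φ.pos, φ.apply_eq⟩

/-- The change of variables formula on the circle. -/
theorem lintegral_jac_mul_comp (G : T → ℝ≥0∞) :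
    ∫⁻ x, ENNReal.ofReal (φ.jac x) * G (φ.toFun x) ∂haar = ∫⁻ x, G x ∂haar := by
  have hvol : ∫⁻ x : T, ENNReal.ofReal (φ.jac x) * G (φ.toFun x) = ∫⁻ x : T, G x := by
    have h := lintegral_image_eq_lintegral_abs_deriv_mul (measurableSet_Ioc (a := 0) (b := 0 + 2 * Real.pi))
      (fun t _ => (φ.hasDerivAt_lift t).hasDerivWithinAt) φ.lift.injective.injOn
      (fun t => G (t : T))
    rw [OrderIso.image_Ioc, lift_add_period, AddCircle.lintegral_preimage] at h
    rw [h, ← AddCircle.lintegral_preimage (2 * Real.pi) 0]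
    refine lintegral_congr fun t => ?_
    rw [abs_of_pos (φ.jac_pos _), coe_lift]
  rw [volume_eq_smul_haarAddCircle, lintegral_smul_measure, lintegral_smul_measure] at hvol
  exact (ENNReal.mul_right_inj (by simp [Real.pi_pos]) ENNReal.ofReal_ne_top).1 hvol

/-- Two-sided bounds on the derivative of a diffeomorphism. -/
def JacBound (M : ℝ) : Prop := ∀ x, φ.jac x ≤ M ∧ (φ.jac x)⁻¹ ≤ M

theorem exists_jacBound : ∃ M, φ.JacBound M := by
  obtain ⟨M, hM⟩ := exists_bound_of_continuous φ.continuous_jac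
  obtain ⟨N, hN⟩ := exists_bound_of_continuous (φ.continuous_jac.inv₀ fun x => (φ.jac_pos x).ne')
  exact ⟨max M N, fun x => ⟨((le_abs_self _).trans (hM x)).trans (le_max_left _ _),
    ((le_abs_self _).trans (hN x)).trans (le_max_right _ _)⟩⟩

variable {φ}

theorem JacBound.symm {M : ℝ} (h : φ.JacBound M) : φ.symm.JacBound M := fun x => by
  rw [jac_symm, inv_inv]
  exact (h _).symm

theorem JacBound.pos {M : ℝ} (h : φ.JacBound M) : 0 < M := (φ.jac_pos 0).trans_le (h 0).1

theorem JacBound.lintegral_comp_le {M : ℝ} (h : φ.JacBound M) (G : T → ℝ≥0∞) :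
    ∫⁻ x, G (φ.toFun x) ∂haar ≤ ENNReal.ofReal M * ∫⁻ x, G x ∂haar := by
  rw [← φ.lintegral_jac_mul_comp G, ← lintegral_const_mul' _ _ (by simp)]
  refine lintegral_mono fun x => ?_
  have h1 : (1 : ℝ≥0∞) ≤ ENNReal.ofReal M * ENNReal.ofReal (φ.jac x) := by
    rw [← ENNReal.ofReal_mul h.pos.le, ← ENNReal.ofReal_one]
    refine ENNReal.ofReal_le_ofReal ?_
    rw [← inv_mul_cancel₀ (φ.jac_pos x).ne']
    exact mul_le_mul_of_nonneg_right (h x).2 (φ.jac_pos x).le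
  rw [← mul_assoc]
  exact le_mul_of_one_le_left (by simp) h1

theorem JacBound.norm_sub_le {M : ℝ} (h : φ.JacBound M) (x y : T) :
    ‖φ.toFun x - φ.toFun y‖ ≤ M * ‖x - y‖ := by
  obtain ⟨k, hk, hk'⟩ := exists_coe_abs_eq (x - y)
  obtain ⟨s, rfl⟩ := QuotientAddGroup.mk_surjective y
  have hx : x = ((s + k : ℝ) : T) := by
    rw [AddCircle.coe_add, hk]; exact (add_sub_cancel _ x).symm
  have h1 : φ.toFun x - φ.toFun (s : T) = ((φ.lift (s + k) - φ.lift s : ℝ) : T) := by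
    rw [hx, AddCircle.coe_sub, coe_lift, coe_lift]
  change ‖φ.toFun x - φ.toFun (s : T)‖ ≤ _
  rw [h1, ← hk']
  refine (norm_coe_le_abs _).trans ?_
  have h2 := convex_univ.norm_image_sub_le_of_norm_hasDerivWithin_le
    (f := φ.lift) (C := M) (x := s) (y := s + k)
    (fun t _ => (φ.hasDerivAt_lift t).hasDerivWithinAt)
    (fun t _ => by rw [Real.norm_of_nonneg (φ.jac_pos _).le]; exact (h _).1) trivial trivial
  simpa using h2

variable (φ)

theorem quasiMeasurePreserving : Measure.QuasiMeasurePreserving φ.toFun haar haar := by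
  refine ⟨φ.continuous_toFun.measurable, Measure.AbsolutelyContinuous.mk fun s hs h0 => ?_⟩
  obtain ⟨M, hM⟩ := φ.exists_jacBound
  rw [Measure.map_apply φ.continuous_toFun.measurable hs]
  have h := hM.lintegral_comp_le (s.indicator 1)
  have e : (fun x => s.indicator (1 : T → ℝ≥0∞) (φ.toFun x)) = (φ.toFun ⁻¹' s).indicator 1 := by
    funext x; rfl
  rw [e, lintegral_indicator_one hs, h0, mul_zero,
    lintegral_indicator_one (φ.continuous_toFun.measurable hs)] at h
  exact le_antisymm h bot_le

theorem comp_ae_eq {E : Type*} {u v : T → E} (h : u =ᵐ[haar] v) :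
    (fun x => u (φ.toFun x)) =ᵐ[haar] fun x => v (φ.toFun x) :=
  φ.quasiMeasurePreserving.ae_eq_comp h

variable {φ} in
theorem JacBound.lintegral_sq_comp_le {M : ℝ} (h : φ.JacBound M) (u : T → ℝ) :
    ∫⁻ x, ‖u (φ.toFun x)‖ₑ ^ 2 ∂haar ≤ ENNReal.ofReal M * ∫⁻ x, ‖u x‖ₑ ^ 2 ∂haar :=
  h.lintegral_comp_le fun x => ‖u x‖ₑ ^ 2

theorem memLp_comp {u : T → ℝ} (hu : MemLp u 2 haar) :
    MemLp (fun x => u (φ.toFun x)) 2 haar := by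
  obtain ⟨M, hM⟩ := φ.exists_jacBound
  refine ⟨hu.1.comp_quasiMeasurePreserving φ.quasiMeasurePreserving, ?_⟩
  have h1 := hu.2
  rw [eLpNorm_lt_top_iff_lintegral_rpow_enorm_lt_top (by norm_num) (by norm_num)] at h1 ⊢
  simp only [ENNReal.toReal_ofNat, ENNReal.rpow_ofNat] at h1 ⊢
  exact (hM.lintegral_sq_comp_le u).trans_lt (ENNReal.mul_lt_top (by simp) h1)

theorem integral_jac_smul_comp (g : T → ℂ) :
    ∫ x, (φ.jac x : ℂ) * g (φ.toFun x) ∂haar = ∫ x, g x ∂haar := by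
  have hmeas : Measurable fun x => ENNReal.ofReal (φ.jac x) :=
    ENNReal.measurable_ofReal.comp φ.continuous_jac.measurable
  have hmap : Measure.map φ.homeo (haar.withDensity fun x => ENNReal.ofReal (φ.jac x)) = haar := by
    refine Measure.ext fun s hs => ?_
    have hs' : MeasurableSet (φ.homeo ⁻¹' s) := φ.homeo.continuous.measurable hs
    rw [Measure.map_apply φ.homeo.continuous.measurable hs, withDensity_apply _ hs',
      ← lintegral_indicator_one hs, ← φ.lintegral_jac_mul_comp, ← lintegral_indicator hs']
    refine lintegral_congr fun x => ?_
    by_cases hx : φ.toFun x ∈ s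
    · have hx' : x ∈ φ.homeo ⁻¹' s := hx
      simp [hx, hx']
    · have hx' : x ∉ φ.homeo ⁻¹' s := hx
      simp [hx, hx']
  conv_rhs => rw [← hmap]
  rw [φ.homeo.measurableEmbedding.integral_map,
    integral_withDensity_eq_integral_toReal_smul hmeas (by simp)]
  refine integral_congr_ae (Filter.Eventually.of_forall fun x => ?_)
  simp only
  rw [ENNReal.toReal_ofReal (φ.jac_pos x).le, Complex.real_smul]
  rfl

end CircleDiffeo

/-! ### The Gagliardo seminorm -/

/-- The kernel `‖h‖^(-1-2σ)` of the Gagliardo seminorm. Its value at `h = 0` is `0` for `σ ≥ 0`; it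
multiplies increments which vanish there. -/
def gagliardoKernel (σ : ℝ) (h : T) : ℝ≥0∞ := ENNReal.ofReal (‖h‖ ^ (-(1 + 2 * σ)))

/-- The square of the Gagliardo seminorm of order `σ`. -/
def gagliardo (σ : ℝ) (u : T → ℝ) : ℝ≥0∞ :=
  ∫⁻ x, ∫⁻ y, ‖u y - u x‖ₑ ^ 2 * gagliardoKernel σ (y - x) ∂haar ∂haar

/-- The Fourier multiplier which represents the Gagliardo seminorm. -/
def gagliardoSymbol (σ : ℝ) (n : ℤ) : ℝ≥0∞ :=
  ∫⁻ h : T, ‖(fourier n h : ℂ) - 1‖ₑ ^ 2 * gagliardoKernel σ h ∂haar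

theorem measurable_gagliardoKernel (σ : ℝ) : Measurable (gagliardoKernel σ) :=
  ENNReal.measurable_ofReal.comp (measurable_norm.pow_const _)

theorem fourierCoeff_translate (u : T → ℂ) (h : T) (n : ℤ) :
    fourierCoeff (fun x => u (x + h)) n = fourier n h * fourierCoeff u n := by
  rw [fourierCoeff, fourierCoeff, ← integral_add_right_eq_self
    (fun x => fourier (-n) x • u x) h, ← integral_const_mul]
  refine integral_congr_ae (Filter.Eventually.of_forall fun x => ?_)
  simp only [smul_eq_mul]
  have h1 : (fourier (-n) (x + h) : ℂ) = fourier (-n) x * fourier (-n) h := by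
    simp only [fourier_apply, smul_add, toCircle_add, Circle.coe_mul]
  have h2 : (fourier n h : ℂ) * fourier (-n) h = 1 := by
    rw [← fourier_add, add_neg_cancel, fourier_zero]
  rw [h1]
  linear_combination (-(fourier (-n) x) * u (x + h)) * h2

/-- The modulus of continuity in `L²` in terms of Fourier coefficients. -/
theorem lintegral_translate_sub {u : T → ℝ} (hu : MemLp u 2 haar) (h : T) :
    ∫⁻ x, ‖u (x + h) - u x‖ₑ ^ 2 ∂haar =
      ∑' n, ‖(fourier n h : ℂ) - 1‖ₑ ^ 2 * ‖coeff u n‖ₑ ^ 2 := by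
  have hU : MemLp (fun x => (u x : ℂ)) 2 haar := hu.ofReal
  have hV : MemLp (fun x => (u (x + h) : ℂ)) 2 haar :=
    hU.comp_measurePreserving (measurePreserving_add_right haar h)
  have h1 := tsum_enorm_sq_fourierCoeff (hV.sub hU)
  have e : ∀ x, ((fun x => (u (x + h) : ℂ)) - fun x => (u x : ℂ)) x = ((u (x + h) - u x : ℝ) : ℂ) :=
    fun x => by simp
  simp only [e, enorm_ofReal] at h1
  rw [← h1]
  refine tsum_congr fun n => ?_
  have h2 := congrFun (fourierCoeff.add (hV.integrable (by norm_num))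
    ((hU.integrable (by norm_num)).neg)) n
  have h3 := fourierCoeff.const_mul (fun x => (u x : ℂ)) (-1) n
  have h4 : (fun x => (-1 : ℂ) * (u x : ℂ)) = -fun x => (u x : ℂ) := by
    funext x; simp
  rw [h4] at h3
  rw [sub_eq_add_neg, h2, Pi.add_apply, h3, fourierCoeff_translate (fun x => (u x : ℂ)), coeff, ← mul_pow, ← enorm_mul]
  congr 2
  ring

theorem gagliardo_eq {u : T → ℝ} (hm : Measurable u) (hu : MemLp u 2 haar) (σ : ℝ) :
    gagliardo σ u = ∑' n, gagliardoSymbol σ n * ‖coeff u n‖ₑ ^ 2 := by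
  have hk := measurable_gagliardoKernel σ
  have h1 : gagliardo σ u =
      ∫⁻ x, ∫⁻ h, ‖u (x + h) - u x‖ₑ ^ 2 * gagliardoKernel σ h ∂haar ∂haar := by
    refine lintegral_congr fun x => ?_
    rw [← lintegral_add_left_eq_self _ x]
    simp only [add_sub_cancel_left]
  rw [h1, lintegral_lintegral_swap]
  · have h2 : ∀ h : T, ∫⁻ x, ‖u (x + h) - u x‖ₑ ^ 2 * gagliardoKernel σ h ∂haar =
        ∑' n, ‖(fourier n h : ℂ) - 1‖ₑ ^ 2 * gagliardoKernel σ h * ‖coeff u n‖ₑ ^ 2 := fun h => by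
      rw [lintegral_mul_const' _ _ (by simp [gagliardoKernel]), lintegral_translate_sub hu,
        ← ENNReal.tsum_mul_right]
      refine tsum_congr fun n => by ring
    simp only [h2]
    rw [lintegral_tsum]
    · refine tsum_congr fun n => ?_
      rw [lintegral_mul_const' _ _ (by simp), gagliardoSymbol]
    · intro n
      have : Measurable fun h : T => ‖(fourier n h : ℂ) - 1‖ₑ :=
        (((map_continuous (fourier n)).sub continuous_const).measurable).enorm
      exact (((this.pow_const 2).mul hk).mul_const _).aemeasurable
  · have m1 : Measurable fun p : T × T => u (p.1 + p.2) - u p.1 :=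
      (hm.comp (measurable_fst.add measurable_snd)).sub (hm.comp measurable_fst)
    exact ((m1.enorm.pow_const 2).mul (hk.comp measurable_snd)).aemeasurable

theorem norm_fourier_sub_one (n : ℤ) (t : ℝ) :
    ‖(fourier n (t : T) : ℂ) - 1‖ = |2 * Real.sin (n * t / 2)| := by
  rw [fourier_coe_apply, ← Real.norm_eq_abs]
  have h := Complex.norm_exp_I_mul_ofReal_sub_one (n * t)
  rw [← h]
  congr 3
  have : (Real.pi : ℂ) ≠ 0 := by exact_mod_cast Real.pi_ne_zero
  push_cast
  field_simp

theorem lintegral_haar_eq (G : T → ℝ≥0∞) :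
    ∫⁻ x, G x ∂haar = ENNReal.ofReal ((2 * Real.pi)⁻¹) *
      ∫⁻ t in Set.Ioc (-Real.pi) Real.pi, G (t : T) := by
  have h := AddCircle.lintegral_preimage (2 * Real.pi) (-Real.pi) G
  rw [show -Real.pi + 2 * Real.pi = Real.pi by ring] at h
  rw [h, volume_eq_smul_haarAddCircle, lintegral_smul_measure, smul_eq_mul, ← mul_assoc,
    ← ENNReal.ofReal_mul (by positivity), inv_mul_cancel₀ (by positivity), ENNReal.ofReal_one,
    one_mul]

theorem lintegral_abs_eq (g : ℝ → ℝ≥0∞) :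
    ∫⁻ t : ℝ, g |t| = 2 * ∫⁻ t in Set.Ioi 0, g t := by
  rw [← lintegral_add_compl (fun t => g |t|) measurableSet_Ioi (A := Set.Ioi 0), two_mul]
  congr 1
  · exact setLIntegral_congr_fun measurableSet_Ioi fun t ht => by
      rw [abs_of_pos ht]
  · rw [Set.compl_Ioi, setLIntegral_congr (Iio_ae_eq_Iic (a := (0 : ℝ))).symm]
    have h := (Measure.measurePreserving_neg (volume : Measure ℝ)).setLIntegral_comp_preimage_emb
      (MeasurableEquiv.neg ℝ).measurableEmbedding (fun t => g |t|) (Set.Iio 0)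
    rw [← h]
    have e : (fun t : ℝ => -t) ⁻¹' Set.Iio 0 = Set.Ioi 0 := by
      ext t; simp
    change ∫⁻ t in (fun t : ℝ => -t) ⁻¹' Set.Iio 0, g |-t| = _
    rw [e]
    exact setLIntegral_congr_fun measurableSet_Ioi fun t ht => by
      rw [abs_neg, abs_of_pos ht]

theorem lintegral_Ioc_rpow {s a : ℝ} (hs : -1 < s) (ha : 0 < a) :
    ∫⁻ t in Set.Ioc 0 a, ENNReal.ofReal (t ^ s) = ENNReal.ofReal (a ^ (s + 1) / (s + 1)) := by
  have hi : IntegrableOn (fun t : ℝ => t ^ s) (Set.Ioc 0 a) := by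
    have := intervalIntegral.intervalIntegrable_rpow' hs (a := 0) (b := a)
    rwa [intervalIntegrable_iff_integrableOn_Ioc_of_le ha.le] at this
  rw [← ofReal_integral_eq_lintegral_ofReal hi
    ((ae_restrict_mem measurableSet_Ioc).mono fun t ht => Real.rpow_nonneg ht.1.le _),
    ← intervalIntegral.integral_of_le ha.le, integral_rpow (Or.inl hs),
    Real.zero_rpow (by linarith), sub_zero]

theorem lintegral_Ioi_rpow {s a : ℝ} (hs : s < -1) (ha : 0 < a) :
    ∫⁻ t in Set.Ioi a, ENNReal.ofReal (t ^ s) = ENNReal.ofReal (-a ^ (s + 1) / (s + 1)) := by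
  rw [← ofReal_integral_eq_lintegral_ofReal (integrableOn_Ioi_rpow_of_lt hs ha)
    ((ae_restrict_mem measurableSet_Ioi).mono fun t ht => Real.rpow_nonneg (ha.trans ht).le _),
    integral_Ioi_rpow_of_lt hs ha]

theorem enorm_sq_eq_ofReal (z : ℂ) : ‖z‖ₑ ^ 2 = ENNReal.ofReal (‖z‖ ^ 2) := by
  rw [ENNReal.ofReal_pow (norm_nonneg _), ofReal_norm]

theorem gagliardoSymbol_zero (σ : ℝ) : gagliardoSymbol σ 0 = 0 := by
  simp [gagliardoSymbol]

theorem gagliardoSymbol_le {σ : ℝ} (h0 : 0 < σ) (h1 : σ < 1) :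
    ∃ C : ℝ≥0∞, C ≠ ⊤ ∧ ∀ n, gagliardoSymbol σ n ≤ C * wt σ n := by
  refine ⟨ENNReal.ofReal ((2 * Real.pi)⁻¹) * (2 * ENNReal.ofReal (1 / (2 - 2 * σ) + 4 / (2 * σ))),
    by finiteness, fun n => ?_⟩
  rcases eq_or_ne n 0 with rfl | hn
  · rw [gagliardoSymbol_zero]; exact bot_le
  set N : ℝ := |(n : ℝ)| with hN
  have hN0 : 0 < N := abs_pos.2 (by exact_mod_cast hn)
  set g : ℝ → ℝ≥0∞ := fun t => ENNReal.ofReal (min 4 (N ^ 2 * t ^ 2) * t ^ (-(1 + 2 * σ))) with hg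
  have hle : ∫⁻ t in Set.Ioc (-Real.pi) Real.pi,
      ‖(fourier n (t : T) : ℂ) - 1‖ₑ ^ 2 * gagliardoKernel σ (t : T) ≤ ∫⁻ t : ℝ, g |t| := by
    refine le_trans (setLIntegral_mono' measurableSet_Ioc fun t ht => ?_)
      (setLIntegral_le_lintegral _ _)
    have ht' : |t| ≤ |2 * Real.pi| / 2 := by
      rw [abs_of_pos Real.two_pi_pos, mul_div_cancel_left₀ _ (by norm_num)]
      exact abs_le.2 ⟨ht.1.le, ht.2⟩
    rw [gagliardoKernel, (AddCircle.norm_coe_eq_abs_iff _ Real.two_pi_pos.ne').2 ht',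
      enorm_sq_eq_ofReal, ← ENNReal.ofReal_mul (by positivity), norm_fourier_sub_one, sq_abs]
    refine ENNReal.ofReal_le_ofReal (mul_le_mul_of_nonneg_right (le_min ?_ ?_) (by positivity))
    · nlinarith [Real.sin_sq_le_one (n * t / 2)]
    · have h2 : |Real.sin (n * t / 2)| ≤ |n * t / 2| := Real.abs_sin_le_abs
      have h3 := sq_le_sq.2 h2
      rw [hN, sq_abs, sq_abs]
      nlinarith
  -- Splitting at `t = 1 / N`, where the two bounds for the increment of `exp (i n t)` balance.
  have hlow : ∫⁻ t in Set.Ioc 0 N⁻¹, g t ≤ ENNReal.ofReal (N ^ (2 * σ) * (1 / (2 - 2 * σ))) := by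
    calc _ ≤ ∫⁻ t in Set.Ioc 0 N⁻¹, ENNReal.ofReal (N ^ 2) * ENNReal.ofReal (t ^ (1 - 2 * σ)) := by
          refine setLIntegral_mono' measurableSet_Ioc fun t ht => ?_
          rw [← ENNReal.ofReal_mul (by positivity)]
          refine ENNReal.ofReal_le_ofReal ?_
          have ht0 : 0 < t := ht.1
          rw [show 1 - 2 * σ = 2 + -(1 + 2 * σ) by ring, Real.rpow_add ht0, Real.rpow_two, ← mul_assoc]
          gcongr
          exact min_le_right _ _
      _ = _ := by
          rw [lintegral_const_mul' _ _ (by simp), lintegral_Ioc_rpow (by linarith) (by positivity),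
            ← ENNReal.ofReal_mul (by positivity)]
          congr 1
          rw [show 1 - 2 * σ + 1 = 2 - 2 * σ by ring, Real.inv_rpow hN0.le, Real.rpow_sub hN0,
            Real.rpow_two]
          have := (Real.rpow_pos_of_pos hN0 (2 * σ)).ne'
          field_simp
  have hhigh : ∫⁻ t in Set.Ioi N⁻¹, g t ≤ ENNReal.ofReal (N ^ (2 * σ) * (4 / (2 * σ))) := by
    calc _ ≤ ∫⁻ t in Set.Ioi N⁻¹, ENNReal.ofReal 4 * ENNReal.ofReal (t ^ (-(1 + 2 * σ))) := by
          refine setLIntegral_mono' measurableSet_Ioi fun t ht => ?_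
          rw [← ENNReal.ofReal_mul (by positivity)]
          refine ENNReal.ofReal_le_ofReal ?_
          have ht0 : 0 < t := (inv_pos.2 hN0).trans ht
          gcongr
          exact min_le_left _ _
      _ = _ := by
          rw [lintegral_const_mul' _ _ (by simp), lintegral_Ioi_rpow (by linarith) (by positivity),
            ← ENNReal.ofReal_mul (by positivity)]
          congr 1
          rw [show -(1 + 2 * σ) + 1 = -(2 * σ) by ring, Real.inv_rpow hN0.le, Real.rpow_neg hN0.le,
            inv_inv]
          field_simp
  have hNw : ENNReal.ofReal (N ^ (2 * σ)) ≤ wt σ n := by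
    refine ENNReal.ofReal_le_ofReal ?_
    rw [Real.rpow_mul hN0.le, Real.rpow_two, hN, sq_abs]
    gcongr
    linarith
  rw [gagliardoSymbol, lintegral_haar_eq, mul_assoc]
  gcongr
  refine hle.trans ?_
  rw [lintegral_abs_eq, mul_assoc]
  gcongr
  rw [← Set.Ioc_union_Ioi_eq_Ioi (inv_pos.2 hN0).le]
  refine (lintegral_union_le _ _ _).trans ((add_le_add hlow hhigh).trans ?_)
  have : 0 < 2 - 2 * σ := by linarith
  rw [← ENNReal.ofReal_add (by positivity) (by positivity), ← mul_add,
    ENNReal.ofReal_mul (by positivity), mul_comm]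
  gcongr

theorem le_gagliardoSymbol {σ : ℝ} (h0 : 0 < σ) (h1 : σ < 1) :
    ∃ C : ℝ≥0∞, C ≠ ⊤ ∧ ∀ n, wt σ n ≤ C * (1 + gagliardoSymbol σ n) := by
  have hc0 : 0 < (2 * Real.pi)⁻¹ * (4 / Real.pi ^ 2 * (1 / (2 - 2 * σ))) := by
    have : 0 < 2 - 2 * σ := by linarith
    positivity
  set c : ℝ := (2 * Real.pi)⁻¹ * (4 / Real.pi ^ 2 * (1 / (2 - 2 * σ))) with hc
  refine ⟨1 + ENNReal.ofReal (2 ^ σ / c), by finiteness, fun n => ?_⟩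
  rcases eq_or_ne n 0 with rfl | hn
  · rw [gagliardoSymbol_zero]
    simp [wt]
  set N : ℝ := |(n : ℝ)| with hN
  have hN1 : 1 ≤ N := by
    rw [hN]; exact_mod_cast Int.one_le_abs hn
  have hN0 : 0 < N := by linarith
  -- On `0 < t ≤ 1 / N` Jordan's inequality bounds the increment of `exp (i n t)` from below.
  have key : ENNReal.ofReal (c * N ^ (2 * σ)) ≤ gagliardoSymbol σ n := by
    rw [gagliardoSymbol, lintegral_haar_eq, hc, mul_assoc, ENNReal.ofReal_mul (by positivity)]
    gcongr
    have hsub : Set.Ioc 0 N⁻¹ ⊆ Set.Ioc (-Real.pi) Real.pi := by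
      have : N⁻¹ ≤ 1 := inv_le_one_of_one_le₀ hN1
      exact Set.Ioc_subset_Ioc (by linarith [Real.pi_pos]) (by linarith [Real.pi_gt_three])
    calc _ = ∫⁻ t in Set.Ioc 0 N⁻¹, ENNReal.ofReal (4 / Real.pi ^ 2 * N ^ 2) *
          ENNReal.ofReal (t ^ (1 - 2 * σ)) := by
          have : 0 < 2 - 2 * σ := by linarith
          rw [lintegral_const_mul' _ _ (by simp), lintegral_Ioc_rpow (by linarith) (by positivity),
            ← ENNReal.ofReal_mul (by positivity)]
          congr 1
          rw [show 1 - 2 * σ + 1 = 2 - 2 * σ by ring, Real.inv_rpow hN0.le, Real.rpow_sub hN0,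
            Real.rpow_two]
          have := (Real.rpow_pos_of_pos hN0 (2 * σ)).ne'
          field_simp
      _ ≤ ∫⁻ t in Set.Ioc 0 N⁻¹, ‖(fourier n (t : T) : ℂ) - 1‖ₑ ^ 2 * gagliardoKernel σ (t : T) := by
          refine setLIntegral_mono' measurableSet_Ioc fun t ht => ?_
          have ht0 : 0 < t := ht.1
          have ht' : |t| ≤ |2 * Real.pi| / 2 := by
            rw [abs_of_pos Real.two_pi_pos, mul_div_cancel_left₀ _ (by norm_num)]
            exact abs_le.2 ⟨(hsub ht).1.le, (hsub ht).2⟩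
          rw [gagliardoKernel, (AddCircle.norm_coe_eq_abs_iff _ Real.two_pi_pos.ne').2 ht',
            enorm_sq_eq_ofReal, ← ENNReal.ofReal_mul (by positivity), norm_fourier_sub_one,
            sq_abs (2 * _), abs_of_pos ht0, ← ENNReal.ofReal_mul (by positivity)]
          refine ENNReal.ofReal_le_ofReal ?_
          rw [show 1 - 2 * σ = 2 + -(1 + 2 * σ) by ring, Real.rpow_add ht0, Real.rpow_two, ← mul_assoc]
          refine mul_le_mul_of_nonneg_right ?_ (by positivity)
          have hNt : N * t ≤ 1 := by
            calc N * t ≤ N * N⁻¹ := by gcongr; exact ht.2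
              _ = 1 := mul_inv_cancel₀ hN0.ne'
          have h2 := Real.mul_le_sin (x := N * t / 2) (by positivity)
            (by linarith [Real.pi_gt_three])
          have h3 : Real.sin (n * t / 2) ^ 2 = Real.sin (N * t / 2) ^ 2 := by
            rw [hN]
            rcases abs_cases (n : ℝ) with h | h
            · rw [h.1]
            · rw [h.1, neg_mul, neg_div, Real.sin_neg, neg_sq]
          have h4 := pow_le_pow_left₀ (by positivity) h2 2
          rw [mul_pow, h3]
          have h5 : (2 / Real.pi * (N * t / 2)) ^ 2 = (4 / Real.pi ^ 2 * N ^ 2 * t ^ 2) / 4 := by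
            field_simp
          rw [h5] at h4
          linarith
      _ ≤ _ := lintegral_mono_set hsub
  have hw : wt σ n ≤ ENNReal.ofReal (2 ^ σ / c) * ENNReal.ofReal (c * N ^ (2 * σ)) := by
    rw [← ENNReal.ofReal_mul (by positivity)]
    refine ENNReal.ofReal_le_ofReal ?_
    rw [← mul_assoc, div_mul_cancel₀ _ hc0.ne', Real.rpow_mul hN0.le, Real.rpow_two,
      ← Real.mul_rpow (by norm_num) (by positivity), hN, sq_abs]
    refine Real.rpow_le_rpow (by positivity) ?_ h0.le
    have : (1 : ℝ) ≤ (n : ℝ) ^ 2 := by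
      rw [← sq_abs]; nlinarith
    linarith
  refine hw.trans ?_
  gcongr
  · exact le_add_self
  · exact key.trans le_add_self

/-- For `0 < σ < 1` the Sobolev norm is equivalent to the Gagliardo norm. -/
theorem exists_energy_equiv_gagliardo {σ : ℝ} (h0 : 0 < σ) (h1 : σ < 1) :
    ∃ C : ℝ≥0∞, C ≠ ⊤ ∧ ∀ u : T → ℝ, Measurable u → MemLp u 2 haar →
      energy σ u ≤ C * (energy 0 u + gagliardo σ u) ∧ gagliardo σ u ≤ C * energy σ u := by
  obtain ⟨C, hC, h⟩ := gagliardoSymbol_le h0 h1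
  obtain ⟨C', hC', h'⟩ := le_gagliardoSymbol h0 h1
  refine ⟨C + C', ENNReal.add_ne_top.2 ⟨hC, hC'⟩, fun u hm hu => ⟨?_, ?_⟩⟩
  · rw [gagliardo_eq hm hu, energy_eq, energy_eq, ← ENNReal.tsum_add, ← ENNReal.tsum_mul_left]
    refine ENNReal.tsum_le_tsum fun n => ?_
    rw [wt_zero, ← add_mul, ← mul_assoc]
    gcongr
    exact (h' n).trans (by gcongr; exact le_add_self)
  · rw [gagliardo_eq hm hu, energy_eq, ← ENNReal.tsum_mul_left]
    refine ENNReal.tsum_le_tsum fun n => ?_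
    rw [← mul_assoc]
    gcongr
    exact (h n).trans (by gcongr; exact le_self_add)

/-- The Gagliardo norm turns bounds on increments into bounds in `H^σ`. -/
theorem exists_energy_le_of_gagliardo_le {σ : ℝ} (h0 : 0 ≤ σ) (h1 : σ < 1) (A : ℝ≥0∞) (hA : A ≠ ⊤) :
    ∃ K : ℝ≥0∞, K ≠ ⊤ ∧ ∀ u w : T → ℝ, Measurable u → MemLp u 2 haar → Measurable w →
      MemLp w 2 haar → energy 0 w ≤ A * energy 0 u → gagliardo σ w ≤ A * gagliardo σ u →
      energy σ w ≤ K * energy σ u := by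
  rcases h0.eq_or_lt with rfl | h0
  · exact ⟨A, hA, fun u w _ _ _ _ h _ => h⟩
  obtain ⟨C, hC, h⟩ := exists_energy_equiv_gagliardo h0 h1
  refine ⟨C * (A * (1 + C)), by finiteness, fun u w hum hu hwm hw ha hb => ?_⟩
  refine (h w hwm hw).1.trans ?_
  rw [mul_assoc C]
  gcongr
  calc energy 0 w + gagliardo σ w ≤ A * energy σ u + A * (C * energy σ u) := by
        gcongr
        · exact ha.trans (by gcongr; exact energy_mono h0.le u)
        · exact hb.trans (by gcongr; exact (h u hum hu).2)
    _ = _ := by ring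

theorem CircleDiffeo.JacBound.gagliardo_comp_le {φ : CircleDiffeo} {M : ℝ} (h : φ.JacBound M) {σ : ℝ}
    (h0 : 0 ≤ σ) (u : T → ℝ) :
    gagliardo σ (fun x => u (φ.toFun x)) ≤
      ENNReal.ofReal (M ^ (1 + 2 * σ)) * (ENNReal.ofReal M * ENNReal.ofReal M) * gagliardo σ u := by
  have hM := h.pos
  have hk : ∀ x y, gagliardoKernel σ (y - x) ≤
      ENNReal.ofReal (M ^ (1 + 2 * σ)) * gagliardoKernel σ (φ.toFun y - φ.toFun x) := fun x y => by
    rw [gagliardoKernel, gagliardoKernel, ← ENNReal.ofReal_mul (by positivity)]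
    refine ENNReal.ofReal_le_ofReal ?_
    rcases eq_or_ne y x with rfl | hxy
    · rw [sub_self, norm_zero, Real.zero_rpow (by linarith)]
      positivity
    have hxy' : 0 < ‖φ.toFun y - φ.toFun x‖ := by
      rw [norm_pos_iff, sub_ne_zero]
      exact fun he => hxy (φ.homeo.injective he)
    rw [Real.rpow_neg hxy'.le, Real.rpow_neg (norm_nonneg _), ← div_eq_mul_inv,
      ← Real.div_rpow hM.le hxy'.le, ← Real.inv_rpow (norm_nonneg _)]
    refine Real.rpow_le_rpow (by positivity) ?_ (by linarith)
    rw [le_div_iff₀ hxy', inv_mul_le_iff₀ (norm_pos_iff.2 (sub_ne_zero.2 hxy))]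
    exact (h.norm_sub_le y x).trans (le_of_eq (mul_comm _ _))
  calc gagliardo σ (fun x => u (φ.toFun x))
      ≤ ∫⁻ x, ∫⁻ y, ENNReal.ofReal (M ^ (1 + 2 * σ)) *
          (‖u (φ.toFun y) - u (φ.toFun x)‖ₑ ^ 2 *
            gagliardoKernel σ (φ.toFun y - φ.toFun x)) ∂haar ∂haar := by
        refine lintegral_mono fun x => lintegral_mono fun y => ?_
        refine (mul_le_mul_right (hk x y) _).trans (le_of_eq ?_)
        ring
    _ ≤ ∫⁻ x, ENNReal.ofReal (M ^ (1 + 2 * σ)) * (ENNReal.ofReal M * ∫⁻ y,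
          ‖u y - u (φ.toFun x)‖ₑ ^ 2 * gagliardoKernel σ (y - φ.toFun x) ∂haar) ∂haar := by
        refine lintegral_mono fun x => ?_
        rw [lintegral_const_mul' _ _ (by simp)]
        gcongr
        exact h.lintegral_comp_le fun z => ‖u z - u (φ.toFun x)‖ₑ ^ 2 *
          gagliardoKernel σ (z - φ.toFun x)
    _ ≤ ENNReal.ofReal (M ^ (1 + 2 * σ)) * (ENNReal.ofReal M *
          (ENNReal.ofReal M * gagliardo σ u)) := by
        rw [lintegral_const_mul' _ _ (by simp), lintegral_const_mul' _ _ (by simp)]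
        gcongr
        exact h.lintegral_comp_le fun z => ∫⁻ y, ‖u y - u z‖ₑ ^ 2 * gagliardoKernel σ (y - z) ∂haar
    _ = _ := by ring

/-- Composition with a diffeomorphism in `H^σ` for `σ < 1`: only bounds on the first derivative
enter. -/
theorem exists_energy_comp_le_of_lt_one {σ : ℝ} (h0 : 0 ≤ σ) (h1 : σ < 1) (M : ℝ) :
    ∃ K : ℝ≥0∞, K ≠ ⊤ ∧ ∀ φ : CircleDiffeo, φ.JacBound M → ∀ u : T → ℝ, MemLp u 2 haar →
      energy σ (fun x => u (φ.toFun x)) ≤ K * energy σ u := by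
  obtain ⟨K, hK, h⟩ := exists_energy_le_of_gagliardo_le h0 h1
    (ENNReal.ofReal M + ENNReal.ofReal (M ^ (1 + 2 * σ)) * (ENNReal.ofReal M * ENNReal.ofReal M))
    (by finiteness)
  refine ⟨K, hK, fun φ hφ u hu => ?_⟩
  -- The Gagliardo formula interchanges integrals, so a measurable representative is chosen.
  have hm := hu.1.aemeasurable.measurable_mk
  have he := hu.1.aemeasurable.ae_eq_mk
  set v := hu.1.aemeasurable.mk u
  have hv : MemLp v 2 haar := hu.ae_eq he
  rw [energy_congr he, energy_congr (φ.comp_ae_eq he)]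
  refine h v _ hm hv (hm.comp φ.continuous_toFun.measurable) (φ.memLp_comp hv) ?_ ?_
  · rw [energy_zero hv, energy_zero (φ.memLp_comp hv)]
    refine (hφ.lintegral_sq_comp_le v).trans ?_
    gcongr
    exact le_self_add
  · refine (hφ.gagliardo_comp_le h0 v).trans ?_
    gcongr
    exact le_add_self

/-! ### The chain rule and the product rule for weak derivatives -/

theorem memLp_mul_continuous {u v : T → ℝ} (hu : MemLp u 2 haar) (hv : Continuous v) :
    MemLp (fun x => u x * v x) 2 haar := by
  obtain ⟨M, hM⟩ := exists_bound_of_continuous hv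
  refine (hu.const_mul M).mono (hu.1.mul hv.aestronglyMeasurable)
    (Filter.Eventually.of_forall fun x => ?_)
  rw [norm_mul, norm_mul, mul_comm]
  gcongr
  exact (hM x).trans (le_abs_self M)

/-- Integration by parts against a `C¹` function. -/
theorem IsWeakDeriv.integral_mul {u v : T → ℝ} (h : IsWeakDeriv u v) {w w' : T → ℂ}
    (hw : IsC1 w w') : ∫ x, (v x : ℂ) * w x ∂haar = -∫ x, (u x : ℂ) * w' x ∂haar := by
  have mw : MemLp w 2 haar :=
    hw.continuous.memLp_of_hasCompactSupport (HasCompactSupport.of_compactSpace w)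
  have mw' : MemLp w' 2 haar :=
    hw.continuous_deriv.memLp_of_hasCompactSupport (HasCompactSupport.of_compactSpace w')
  have h1 := hasSum_fourierCoeff_mul (u := fun x => (v x : ℂ)) h.memLp_deriv.ofReal mw 0
  have h2 := (hasSum_fourierCoeff_mul (u := fun x => (u x : ℂ)) h.memLp.ofReal mw' 0).neg
  have e0 : ∀ f : T → ℂ, fourierCoeff f 0 = ∫ x, f x ∂haar := fun f => by
    rw [fourierCoeff]
    simp only [neg_zero, fourier_zero, one_smul]
  rw [e0] at h1 h2
  have e1 : ∀ m, fourierCoeff (fun x => (v x : ℂ)) (0 - m) * fourierCoeff w m =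
      -(fourierCoeff (fun x => (u x : ℂ)) (0 - m) * fourierCoeff w' m) := fun m => by
    have h3 : fourierCoeff (fun x => (v x : ℂ)) (0 - m) =
        Complex.I * (0 - m : ℤ) * fourierCoeff (fun x => (u x : ℂ)) (0 - m) :=
      congrFun h.coeff_eq (0 - m)
    rw [h3, hw.fourierCoeff_deriv]
    push_cast
    ring
  simp only [e1] at h1
  exact h1.unique h2

/-- The chain rule `(u ∘ φ)_x = (u_x ∘ φ) φ_x`. -/
theorem IsWeakDeriv.comp {u v : T → ℝ} (h : IsWeakDeriv u v) (φ : CircleDiffeo) :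
    IsWeakDeriv (fun x => u (φ.toFun x)) fun x => v (φ.toFun x) * φ.jac x := by
  refine ⟨φ.memLp_comp h.memLp, memLp_mul_continuous (φ.memLp_comp h.memLp_deriv) φ.continuous_jac, ?_⟩
  funext n
  -- After a change of variables the exponential sits on `φ⁻¹`, which is `C¹`, so the derivative can be
  -- moved onto it even if `u` is only of class `H¹`.
  set W : T → ℂ := fun y => fourier (-n) (φ.inv y) with hW
  set W' : T → ℂ := fun y => φ.symm.jac y • (Complex.I * (-n : ℤ) * fourier (-n) (φ.inv y)) with hW'
  have hC1 : IsC1 W W' := by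
    refine ⟨fun t => ?_, ?_⟩
    · have h1 := (hasDerivAt_fourier_circle (-n) (φ.symm.lift t)).scomp t (φ.symm.hasDerivAt_lift t)
      have e : (fun s : ℝ => (fourier (-n) (s : T) : ℂ)) ∘ φ.symm.lift = fun s : ℝ => W s := by
        funext s
        rw [Function.comp_apply, φ.symm.coe_lift]
        rfl
      rw [e, φ.symm.coe_lift] at h1
      exact h1
    · exact φ.symm.continuous_jac.smul
        (continuous_const.mul ((map_continuous (fourier (-n))).comp φ.continuous_inv))
  have h1 := h.integral_mul hC1
  have h2 := φ.integral_jac_smul_comp fun y => (v y : ℂ) * W y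
  have h3 : ∫ x, (φ.symm.jac x : ℂ) * ((u (φ.toFun (φ.inv x)) : ℂ) * fourier (-n) (φ.inv x)) ∂haar =
      ∫ x, (u (φ.toFun x) : ℂ) * fourier (-n) x ∂haar :=
    φ.symm.integral_jac_smul_comp fun x => (u (φ.toFun x) : ℂ) * fourier (-n) x
  have e1 : coeff (fun x => v (φ.toFun x) * φ.jac x) n =
      ∫ x, (φ.jac x : ℂ) * ((v (φ.toFun x) : ℂ) * W (φ.toFun x)) ∂haar := by
    rw [coeff, fourierCoeff]
    refine integral_congr_ae (Filter.Eventually.of_forall fun x => ?_)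
    simp only [hW, φ.left_inv, smul_eq_mul]
    push_cast
    ring
  have e2 : -∫ x, (u x : ℂ) * W' x ∂haar = Complex.I * n *
      ∫ x, (φ.symm.jac x : ℂ) * ((u (φ.toFun (φ.inv x)) : ℂ) *
        fourier (-n) (φ.inv x)) ∂haar := by
    rw [← integral_neg, ← integral_const_mul]
    refine integral_congr_ae (Filter.Eventually.of_forall fun x => ?_)
    simp only [hW', φ.right_inv, Complex.real_smul]
    push_cast
    ring
  rw [e1, h2, h1, e2, h3, dx, coeff, fourierCoeff]
  congr 1
  refine integral_congr_ae (Filter.Eventually.of_forall fun x => ?_)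
  simp only [smul_eq_mul]
  ring

/-- The product rule. -/
theorem IsWeakDeriv.coeff_mul {u u' v v' : T → ℝ} (hu : IsWeakDeriv u u') (hv : IsWeakDeriv v v')
    (n : ℤ) : coeff (fun x => u' x * v x) n + coeff (fun x => u x * v' x) n =
      Complex.I * n * coeff (fun x => u x * v x) n := by
  have h1 := (hasSum_coeff_mul hu.memLp_deriv hv.memLp n).add
    (hasSum_coeff_mul hu.memLp hv.memLp_deriv n)
  have h2 := (hasSum_coeff_mul hu.memLp hv.memLp n).mul_left (Complex.I * n)
  have e : ∀ m, coeff u' (n - m) * coeff v m + coeff u (n - m) * coeff v' m =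
      Complex.I * n * (coeff u (n - m) * coeff v m) := fun m => by
    rw [hu.coeff_eq, hv.coeff_eq, dx, dx]
    push_cast
    ring
  simp only [e] at h1
  exact h1.unique h2

/-! ### Reciprocals -/

theorem energy_one (u : T → ℝ) :
    energy 1 u = energy 0 u + ∑' n : ℤ, ‖Complex.I * n‖ₑ ^ 2 * ‖coeff u n‖ₑ ^ 2 := by
  rw [energy_eq, energy_eq, ← ENNReal.tsum_add]
  refine tsum_congr fun n => ?_
  rw [wt_one, wt_zero]
  ring

/-- `H¹` bounds are preserved by Lipschitz maps, by comparison of difference quotients. -/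
theorem tsum_le_of_norm_sub_le {u w : T → ℝ} (hu : MemLp u 2 haar) (hw : MemLp w 2 haar) {B : ℝ}
    (hB : 0 ≤ B) (h : ∀ x y, |w x - w y| ≤ B * |u x - u y|) :
    ∑' n : ℤ, ‖Complex.I * n‖ₑ ^ 2 * ‖coeff w n‖ₑ ^ 2 ≤
      ENNReal.ofReal (B ^ 2) * ∑' n : ℤ, ‖Complex.I * n‖ₑ ^ 2 * ‖coeff u n‖ₑ ^ 2 := by
  -- `Q t n` is the Fourier multiplier of the difference quotient.
  set Q : ℝ → ℤ → ℂ := fun t n => t⁻¹ • ((fourier n (t : T) : ℂ) - 1) with hQ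
  have hQlim : ∀ n, Filter.Tendsto (fun t => Q t n) (nhdsWithin 0 {0}ᶜ) (nhds (Complex.I * n)) := fun n => by
    have h1 := (hasDerivAt_fourier_circle n 0).tendsto_slope_zero
    simpa [hQ] using h1
  have hQle : ∀ t n, ‖Q t n‖ₑ ≤ ‖Complex.I * n‖ₑ := fun t n => by
    rw [← ofReal_norm, ← ofReal_norm]
    refine ENNReal.ofReal_le_ofReal ?_
    rw [hQ]
    simp only
    rw [norm_smul, norm_fourier_sub_one, norm_mul, Complex.norm_I, one_mul, Complex.norm_intCast,
      norm_inv, Real.norm_eq_abs, abs_mul, abs_two]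
    rcases eq_or_ne t 0 with rfl | ht
    · simp
    · rw [inv_mul_le_iff₀ (abs_pos.2 ht)]
      have h2 := Real.abs_sin_le_abs (x := (n : ℝ) * t / 2)
      rw [abs_div, abs_mul, abs_two] at h2
      linarith
  have key : ∀ t : ℝ, ∑' n, ‖Q t n‖ₑ ^ 2 * ‖coeff w n‖ₑ ^ 2 ≤
      ENNReal.ofReal (B ^ 2) * ∑' n : ℤ, ‖Complex.I * n‖ₑ ^ 2 * ‖coeff u n‖ₑ ^ 2 := fun t => by
    have e : ∀ f : T → ℝ, MemLp f 2 haar → ∑' n, ‖Q t n‖ₑ ^ 2 * ‖coeff f n‖ₑ ^ 2 =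
        ‖t⁻¹‖ₑ ^ 2 * ∫⁻ x, ‖f (x + (t : T)) - f x‖ₑ ^ 2 ∂haar := fun f hf => by
      rw [lintegral_translate_sub hf, ← ENNReal.tsum_mul_left]
      refine tsum_congr fun n => ?_
      rw [hQ]
      simp only
      rw [enorm_smul, mul_pow, mul_assoc]
    calc _ = ‖t⁻¹‖ₑ ^ 2 * ∫⁻ x, ‖w (x + (t : T)) - w x‖ₑ ^ 2 ∂haar := e w hw
      _ ≤ ‖t⁻¹‖ₑ ^ 2 * ∫⁻ x, ENNReal.ofReal (B ^ 2) * ‖u (x + (t : T)) - u x‖ₑ ^ 2 ∂haar := by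
          gcongr with x
          rw [ENNReal.ofReal_pow hB, ← mul_pow, Real.enorm_eq_ofReal_abs, Real.enorm_eq_ofReal_abs,
            ← ENNReal.ofReal_mul hB]
          gcongr
          exact h _ _
      _ = ENNReal.ofReal (B ^ 2) * ∑' n, ‖Q t n‖ₑ ^ 2 * ‖coeff u n‖ₑ ^ 2 := by
          rw [lintegral_const_mul' _ _ (by simp), e u hu]; ring
      _ ≤ _ := by
          gcongr with n
          exact hQle t n
  rw [ENNReal.tsum_eq_iSup_sum]
  refine iSup_le fun s => ?_
  have hlim : Filter.Tendsto (fun t => ∑ n ∈ s, ‖Q t n‖ₑ ^ 2 * ‖coeff w n‖ₑ ^ 2) (nhdsWithin 0 {0}ᶜ)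
      (nhds (∑ n ∈ s, ‖Complex.I * n‖ₑ ^ 2 * ‖coeff w n‖ₑ ^ 2)) := by
    refine tendsto_finsetSum _ fun n _ => ?_
    refine ENNReal.Tendsto.mul_const ?_ (Or.inr (by simp))
    exact ((ENNReal.continuous_pow 2).tendsto _).comp ((hQlim n).enorm)
  exact le_of_tendsto hlim (Filter.Eventually.of_forall fun t => (ENNReal.sum_le_tsum s).trans (key t))

theorem abs_inv_sub_inv_le {a b M : ℝ} (ha : 0 < a) (hb : 0 < b) (haM : a⁻¹ ≤ M) (hbM : b⁻¹ ≤ M) :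
    |a⁻¹ - b⁻¹| ≤ M ^ 2 * |a - b| := by
  have e : a⁻¹ - b⁻¹ = (a⁻¹ * b⁻¹) * (b - a) := by field_simp
  have hM : 0 ≤ M := (inv_pos.2 ha).le.trans haM
  rw [e, abs_mul, abs_sub_comm b a, abs_of_pos (by positivity), sq]
  gcongr

theorem enorm_sq_le_mul_of_abs_le {a b B : ℝ} (hB : 0 ≤ B) (h : |a| ≤ B * |b|) :
    ‖a‖ₑ ^ 2 ≤ ENNReal.ofReal (B ^ 2) * ‖b‖ₑ ^ 2 := by
  rw [ENNReal.ofReal_pow hB, ← mul_pow, Real.enorm_eq_ofReal_abs, Real.enorm_eq_ofReal_abs,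
    ← ENNReal.ofReal_mul hB]
  gcongr

section Reciprocal

variable {J : T → ℝ} {M : ℝ}

theorem energy_zero_inv_le (hJ : Continuous J) (hpos : ∀ x, 0 < J x) (hM : ∀ x, (J x)⁻¹ ≤ M) :
    energy 0 (fun x => (J x)⁻¹) ≤ ENNReal.ofReal ((M ^ 2) ^ 2) * energy 0 J := by
  have hK : Continuous fun x => (J x)⁻¹ := hJ.inv₀ fun x => (hpos x).ne'
  rw [energy_zero (memLp_of_continuous hJ), energy_zero (memLp_of_continuous hK),
    ← lintegral_const_mul' _ _ (by simp)]
  refine lintegral_mono fun x => enorm_sq_le_mul_of_abs_le (by positivity) ?_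
  have h1 := inv_pos.2 (hpos x)
  rw [abs_of_pos h1, abs_of_pos (hpos x)]
  calc (J x)⁻¹ = (J x)⁻¹ ^ 2 * J x := by field_simp [(hpos x).ne']
    _ ≤ M ^ 2 * J x := by
        have := (hpos x).le
        gcongr
        exact hM x

theorem gagliardo_inv_le (hpos : ∀ x, 0 < J x) (hM : ∀ x, (J x)⁻¹ ≤ M) (σ : ℝ) :
    gagliardo σ (fun x => (J x)⁻¹) ≤ ENNReal.ofReal ((M ^ 2) ^ 2) * gagliardo σ J := by
  rw [gagliardo, gagliardo, ← lintegral_const_mul' _ _ (by simp)]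
  refine lintegral_mono fun x => ?_
  rw [← lintegral_const_mul' _ _ (by simp)]
  refine lintegral_mono fun y => ?_
  rw [← mul_assoc]
  gcongr
  exact enorm_sq_le_mul_of_abs_le (by positivity)
    (abs_inv_sub_inv_le (hpos y) (hpos x) (hM y) (hM x))

theorem energy_one_inv_le (hJ : Continuous J) (hpos : ∀ x, 0 < J x) (hM : ∀ x, (J x)⁻¹ ≤ M) :
    energy 1 (fun x => (J x)⁻¹) ≤ ENNReal.ofReal ((M ^ 2) ^ 2) * energy 1 J := by
  have hK : Continuous fun x => (J x)⁻¹ := hJ.inv₀ fun x => (hpos x).ne'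
  rw [energy_one, energy_one, mul_add]
  exact add_le_add (energy_zero_inv_le hJ hpos hM)
    (tsum_le_of_norm_sub_le (memLp_of_continuous hJ) (memLp_of_continuous hK) (by positivity)
      fun x y => abs_inv_sub_inv_le (hpos x) (hpos y) (hM x) (hM y))

/-- `(1 / J)_x = - J_x / J²`. -/
theorem IsWeakDeriv.inv_ae_eq {j k : T → ℝ} (hJ : Continuous J) (hpos : ∀ x, 0 < J x)
    (hj : IsWeakDeriv J j) (hk : IsWeakDeriv (fun x => (J x)⁻¹) k) :
    k =ᵐ[haar] fun x => -1 * (j x * (J x)⁻¹ * (J x)⁻¹) := by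
  have hK : Continuous fun x => (J x)⁻¹ := hJ.inv₀ fun x => (hpos x).ne'
  have m1 : MemLp (fun x => j x * (J x)⁻¹) 2 haar := memLp_mul_continuous hj.memLp_deriv hK
  have m2 : MemLp (fun x => J x * k x) 2 haar := by
    simpa only [mul_comm] using memLp_mul_continuous hk.memLp_deriv hJ
  have h1 : coeff (fun x => j x * (J x)⁻¹ + J x * k x) = coeff fun _ => 0 := by
    funext n
    rw [coeff_add_fun m1 m2, hj.coeff_mul hk]
    have e : (fun x => J x * (J x)⁻¹) = fun _ => 1 := by
      funext x; exact mul_inv_cancel₀ (hpos x).ne'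
    rw [e, coeff_const, coeff_const]
    by_cases hn : n = 0 <;> simp [hn]
  have h2 := ae_eq_of_coeff_eq (m1.add m2) (memLp_of_continuous continuous_const) h1
  filter_upwards [h2] with x hx
  have h3 := (hpos x).ne'
  have hx' : j x * (J x)⁻¹ + J x * k x = 0 := hx
  have h4 : J x * k x = -(j x * (J x)⁻¹) := by linarith
  calc k x = (J x)⁻¹ * (J x * k x) := by field_simp
    _ = _ := by rw [h4]; ring

end Reciprocal

/-- The reciprocal of a positive function of class `H^s`, `s > 1/2`, is bounded in `H^s` in terms of
the `H^s` norm and of the lower bound of the function. -/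
theorem exists_energy_inv_le {s : ℝ} (hs : 1 / 2 < s) (M : ℝ) {E : ℝ≥0∞} (hE : E ≠ ⊤) (k : ℕ) :
    ∀ σ, 0 ≤ σ → σ ≤ s → σ < k + 1 → ∃ R : ℝ≥0∞, R ≠ ⊤ ∧ ∀ J : T → ℝ, Continuous J →
      (∀ x, 0 < J x) → (∀ x, (J x)⁻¹ ≤ M) → energy s J ≤ E → energy σ (fun x => (J x)⁻¹) ≤ R := by
  have hbase : ∀ σ, 0 ≤ σ → σ ≤ s → σ < 1 → ∃ R : ℝ≥0∞, R ≠ ⊤ ∧ ∀ J : T → ℝ, Continuous J →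
      (∀ x, 0 < J x) → (∀ x, (J x)⁻¹ ≤ M) → energy s J ≤ E →
      energy σ (fun x => (J x)⁻¹) ≤ R := fun σ h0 hσs h1 => by
    obtain ⟨K, hK, h⟩ := exists_energy_le_of_gagliardo_le h0 h1 (ENNReal.ofReal ((M ^ 2) ^ 2))
      (by simp)
    refine ⟨K * E, ENNReal.mul_ne_top hK hE, fun J hJ hpos hM hJE => ?_⟩
    have hc : Continuous fun x => (J x)⁻¹ := hJ.inv₀ fun x => (hpos x).ne'
    refine (h J _ hJ.measurable (memLp_of_continuous hJ) hc.measurable (memLp_of_continuous hc)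
      (energy_zero_inv_le hJ hpos hM) (gagliardo_inv_le hpos hM σ)).trans ?_
    gcongr
    exact (energy_mono hσs J).trans hJE
  induction k with
  | zero => exact fun σ h0 hσs h1 => hbase σ h0 hσs (by simpa using h1)
  | succ k ih =>
    intro σ h0 hσs hσk
    rcases lt_or_ge σ 1 with h1 | h1
    · exact hbase σ h0 hσs h1
    push_cast at hσk
    -- `H^α` acts on `H^(σ-1)` since `α > 1/2` and `α ≥ σ - 1`, and `α < k + 1` for the induction.
    set α := max (σ - 1) (3 / 4) with hα
    have hασ : σ - 1 ≤ α := le_max_left _ _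
    have hα' : 3 / 4 ≤ α := le_max_right _ _
    have hαs : α ≤ s := max_le (by linarith) (by linarith)
    obtain ⟨R, hR, hRb⟩ := ih α (by linarith) hαs (max_lt (by linarith) (by
      have : (0 : ℝ) ≤ k := Nat.cast_nonneg k
      linarith))
    obtain ⟨C, hC, hCb⟩ := exists_energy_mul_le (σ := σ - 1) (τ := α) (by linarith) hασ (by linarith)
    refine ⟨R + C * (C * (E * R) * R), by finiteness, fun J hJ hpos hM hJE => ?_⟩
    have hc : Continuous fun x => (J x)⁻¹ := hJ.inv₀ fun x => (hpos x).ne'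
    have hJs : MemSob s J := memSob_iff.2 ⟨memLp_of_continuous hJ, ne_top_of_le_ne_top hE hJE⟩
    have hK1 : MemSob 1 fun x => (J x)⁻¹ := memSob_iff.2 ⟨memLp_of_continuous hc,
      ne_top_of_le_ne_top (ENNReal.mul_ne_top (by simp) (memSob_iff.1 (hJs.mono (by linarith))).2)
        (energy_one_inv_le hJ hpos hM)⟩
    obtain ⟨j, hj, -⟩ := hJs.exists_isWeakDeriv (by linarith)
    obtain ⟨k', hk, -⟩ := hK1.exists_isWeakDeriv le_rfl
    have hRJ := hRb J hJ hpos hM hJE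
    have hjE : energy (σ - 1) j ≤ E := by
      refine (energy_mono (show σ - 1 ≤ s - 1 by linarith) j).trans (le_trans ?_ hJE)
      rw [energy_of_coeff_eq_dx hj.coeff_eq s]
      exact le_add_self
    rw [energy_of_coeff_eq_dx hk.coeff_eq σ, energy_congr (hj.inv_ae_eq hJ hpos hk), energy_const_mul]
    have m1 := memLp_mul_continuous hj.memLp_deriv hc
    have h3 : energy (σ - 1) (fun x => j x * (J x)⁻¹ * (J x)⁻¹) ≤ C * (C * (E * R) * R) := by
      refine (hCb _ _ m1 (memLp_of_continuous hc)).trans ?_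
      gcongr
      refine (hCb _ _ hj.memLp_deriv (memLp_of_continuous hc)).trans ?_
      gcongr
    refine add_le_add ((energy_mono hασ _).trans hRJ) ?_
    simpa using h3

/-! ### Composition operators -/

theorem MemSob.mul {σ τ : ℝ} (h0 : 0 ≤ σ) (h : σ ≤ τ) (hτ : 1 / 2 < τ) {u v : T → ℝ}
    (hu : MemSob σ u) (hv : MemSob τ v) (hc : Continuous v) : MemSob σ fun x => u x * v x := by
  obtain ⟨K, hK, hKb⟩ := exists_energy_mul_le h0 h hτ
  rw [memSob_iff] at hu hv ⊢
  exact ⟨memLp_mul_continuous hu.1 hc, ne_top_of_le_ne_top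
    (ENNReal.mul_ne_top hK (ENNReal.mul_ne_top hu.2 hv.2)) (hKb u v hu.1 hv.1)⟩

/-- Composition with a diffeomorphism of class `H^q` and with its inverse is bounded in `H^σ`,
`0 ≤ σ ≤ q`, with a bound which depends only on `‖φ_x‖` in `H^(q-1)` and on the bounds of `φ_x` and
`1 / φ_x`. The derivative of `u ∘ φ⁻¹` is `(u_x / φ_x) ∘ φ⁻¹`, so that the norm of `φ⁻¹` in `H^q` is
not needed. -/
theorem exists_energy_comp_le {q : ℝ} (hq : 3 / 2 < q) (M : ℝ) {E : ℝ≥0∞} (hE : E ≠ ⊤) (k : ℕ) :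
    ∀ σ, 0 ≤ σ → σ ≤ q → σ < k + 1 → ∃ R : ℝ≥0∞, R ≠ ⊤ ∧ ∀ φ : CircleDiffeo, φ.JacBound M →
      energy (q - 1) φ.jac ≤ E → ∀ u : T → ℝ, MemSob σ u →
        energy σ (fun x => u (φ.toFun x)) ≤ R * energy σ u ∧
        energy σ (fun x => u (φ.inv x)) ≤ R * energy σ u := by
  have hbase : ∀ σ, 0 ≤ σ → σ < 1 → ∃ R : ℝ≥0∞, R ≠ ⊤ ∧ ∀ φ : CircleDiffeo, φ.JacBound M →
      energy (q - 1) φ.jac ≤ E → ∀ u : T → ℝ, MemSob σ u →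
        energy σ (fun x => u (φ.toFun x)) ≤ R * energy σ u ∧
        energy σ (fun x => u (φ.inv x)) ≤ R * energy σ u := fun σ h0 h1 => by
    obtain ⟨R, hR, h⟩ := exists_energy_comp_le_of_lt_one h0 h1 M
    exact ⟨R, hR, fun φ hφ _ u hu => ⟨h φ hφ u hu.1, h φ.symm hφ.symm u hu.1⟩⟩
  obtain ⟨N, hN⟩ := exists_nat_gt (q - 1)
  obtain ⟨E', hE', hE'b⟩ := exists_energy_inv_le (s := q - 1) (by linarith) M hE N (q - 1)
    (by linarith) le_rfl (by linarith)
  induction k with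
  | zero => exact fun σ h0 _ h1 => hbase σ h0 (by simpa using h1)
  | succ k ih =>
    intro σ h0 hσq hσk
    rcases lt_or_ge σ 1 with h1 | h1
    · exact hbase σ h0 h1
    push_cast at hσk
    obtain ⟨R, hR, hRb⟩ := ih (σ - 1) (by linarith) (by linarith) (by linarith)
    obtain ⟨C, hC, hCb⟩ := exists_energy_mul_le (σ := σ - 1) (τ := q - 1) (by linarith) (by linarith)
      (by linarith)
    refine ⟨R + C * (R * E) + R * (C * E'), by finiteness, fun φ hφ hφE u hu => ?_⟩
    obtain ⟨v, huv, hv⟩ := hu.exists_isWeakDeriv h1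
    have hu1 : MemSob (σ - 1) u := hu.mono (by linarith)
    have hle : energy (σ - 1) u ≤ energy σ u := energy_mono (by linarith) u
    have hle' : energy (σ - 1) v ≤ energy σ u := by
      rw [energy_of_coeff_eq_dx huv.coeff_eq σ]
      exact le_add_self
    constructor
    · rw [energy_of_coeff_eq_dx (huv.comp φ).coeff_eq σ]
      calc _ ≤ R * energy σ u + C * (R * energy σ u * E) := by
            gcongr
            · exact ((hRb φ hφ hφE u hu1).1).trans (by gcongr)
            · refine (hCb _ _ (φ.memLp_comp huv.memLp_deriv) (memLp_of_continuous φ.continuous_jac)).trans ?_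
              gcongr
              exact ((hRb φ hφ hφE v hv).1).trans (by gcongr)
        _ = (R + C * (R * E)) * energy σ u := by ring
        _ ≤ _ := by gcongr ?_ * _; exact le_self_add
    · have hK : Continuous fun x => (φ.jac x)⁻¹ := φ.continuous_jac.inv₀ fun x => (φ.jac_pos x).ne'
      have hKE := hE'b φ.jac φ.continuous_jac φ.jac_pos (fun x => (hφ x).2) hφE
      have hKs : MemSob (q - 1) fun x => (φ.jac x)⁻¹ :=
        memSob_iff.2 ⟨memLp_of_continuous hK, ne_top_of_le_ne_top hE' hKE⟩
      have hvK : MemSob (σ - 1) fun x => v x * (φ.jac x)⁻¹ :=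
        hv.mul (by linarith) (by linarith) (by linarith) hKs hK
      have e : (fun x => v (φ.symm.toFun x) * φ.symm.jac x) =
          fun x => (fun y => v y * (φ.jac y)⁻¹) (φ.inv x) := by
        funext x
        rw [φ.jac_symm]
        rfl
      have hd := (huv.comp φ.symm).coeff_eq
      rw [e] at hd
      have h2 := energy_of_coeff_eq_dx hd σ
      change energy σ (fun x => u (φ.inv x)) = _ at h2
      rw [h2]
      calc _ ≤ R * energy σ u + R * (C * (energy σ u * E')) := by
            gcongr
            · exact ((hRb φ hφ hφE u hu1).2).trans (by gcongr)
            · refine ((hRb φ hφ hφE _ hvK).2).trans ?_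
              gcongr
              refine (hCb _ _ huv.memLp_deriv (memLp_of_continuous hK)).trans ?_
              gcongr
        _ = (R + R * (C * E')) * energy σ u := by ring
        _ ≤ _ := by gcongr; exact le_self_add

/-! ### The group `D^q` -/

theorem continuous_eq_of_ae {f g : T → ℝ} (hf : Continuous f) (hg : Continuous g)
    (h : f =ᵐ[haar] g) : f = g := (Continuous.ae_eq_iff_eq haar hf hg).1 h

theorem memSob_of_const (c σ : ℝ) : MemSob σ fun _ => c := by
  refine ⟨memLp_of_continuous continuous_const, ?_⟩
  refine summable_of_ne_finset_zero (s := {0}) fun n hn => ?_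
  rw [coeff_const, if_neg (by simpa using hn)]
  simp

theorem IsDisplacement.exists_isC1 {q : ℝ} (hq : 3 / 2 < q) {φ : T → T} {f : T → ℝ}
    (hf : IsDisplacement φ f) (hs : MemSob q f) : ∃ f', IsC1 f f' ∧ MemSob (q - 1) f' := by
  obtain ⟨g, g', hg, hgf, hgs⟩ := hs.exists_isC1 hq
  have h := continuous_eq_of_ae hg.continuous hf.1 hgf
  subst h
  exact ⟨g', hg, hgs⟩

theorem IsDisplacement.coe_lift {φ : T → T} {f : T → ℝ} (hf : IsDisplacement φ f) (t : ℝ) :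
    ((t + f (t : T) : ℝ) : T) = φ t := by
  rw [AddCircle.coe_add, hf.2.2]

/-- A homeomorphism whose lift and inverse lift are differentiable has a positive derivative. -/
theorem IsDisplacement.jac_pos {φ : T ≃ₜ T} {f f' g g' : T → ℝ} (hf : IsDisplacement φ f)
    (hg : IsDisplacement φ.symm g) (hf' : IsC1 f f') (hg' : IsC1 g g') (x : T) : 0 < 1 + f' x := by
  obtain ⟨t, rfl⟩ := QuotientAddGroup.mk_surjective x
  set F : ℝ → ℝ := fun s => s + f (s : T) with hF
  set G : ℝ → ℝ := fun s => s + g (s : T) with hG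
  have dF : ∀ s : ℝ, HasDerivAt F (1 + f' (s : T)) s := fun s =>
    (hasDerivAt_id s).add (hf'.hasDerivAt s)
  have dG : ∀ s : ℝ, HasDerivAt G (1 + g' (s : T)) s := fun s =>
    (hasDerivAt_id s).add (hg'.hasDerivAt s)
  have cF : Continuous F := continuous_iff_continuousAt.2 fun s => (dF s).continuousAt
  have cG : Continuous G := continuous_iff_continuousAt.2 fun s => (dG s).continuousAt
  -- `G ∘ F` is a lift of the identity, hence a translation by a constant in `2πℤ`.
  have hmem : ∀ s, G (F s) - s ∈ AddSubgroup.zmultiples (2 * Real.pi) := fun s => by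
    have h1 : ((G (F s) - s : ℝ) : T) = 0 := by
      rw [AddCircle.coe_sub, hg.coe_lift, hf.coe_lift, φ.symm_apply_apply, sub_self]
    obtain ⟨n, hn⟩ := (AddCircle.coe_eq_zero_iff _).1 h1
    exact ⟨n, hn⟩
  have hconst : ∀ s, G (F s) - s = G (F 0) - 0 := fun s => by
    have hc : Continuous fun s => (⟨G (F s) - s, hmem s⟩ : AddSubgroup.zmultiples (2 * Real.pi)) :=
      ((cG.comp cF).sub continuous_id).subtype_mk _
    exact congrArg Subtype.val (PreconnectedSpace.constant inferInstance hc (x := s) (y := 0))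
  have h1 : HasDerivAt (G ∘ F) ((1 + g' (F t : T)) * (1 + f' (t : T))) t := (dG (F t)).comp t (dF t)
  have h2 : HasDerivAt (G ∘ F) 1 t := by
    have e : G ∘ F = fun s => s + (G (F 0) - 0) := by
      funext s
      have := hconst s
      simp only [Function.comp_apply]
      linarith
    rw [e]
    exact (hasDerivAt_id t).add_const _
  have h3 := h1.unique h2
  have h4 : 0 ≤ 1 + f' (t : T) := by
    rw [← (dF t).deriv]
    exact hf.2.1.monotone.deriv_nonneg
  refine lt_of_le_of_ne h4 fun h5 => ?_
  rw [← h5, mul_zero] at h3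
  exact zero_ne_one h3

/-- The elements of `D^q` are `C¹` diffeomorphisms. -/
theorem D.exists_circleDiffeo {q : ℝ} (hq : 3 / 2 < q) (φ : D q) :
    ∃ Φ : CircleDiffeo, Φ.toFun = φ.toHomeo ∧ Φ.inv = φ.toHomeo.symm ∧ Φ.jac = φ.deriv ∧
      MemSob (q - 1) Φ.jac := by
  obtain ⟨hf, hfs⟩ := φ.exists_displacement.choose_spec
  obtain ⟨g, hg, hgs⟩ := φ.exists_displacement_symm
  obtain ⟨f', hf', hfs'⟩ := hf.exists_isC1 hq hfs
  obtain ⟨g', hg', -⟩ := hg.exists_isC1 hq hgs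
  refine ⟨⟨φ.toHomeo, φ.toHomeo.symm, φ.displacement, f', hf', hf.jac_pos hg hf' hg', hf.2.2,
    φ.toHomeo.symm_apply_apply, φ.toHomeo.apply_symm_apply⟩, rfl, rfl, ?_, ?_⟩
  · funext x
    obtain ⟨s, rfl⟩ := QuotientAddGroup.mk_surjective x
    change 1 + f' (s : T) = 1 + _root_.deriv (fun t : ℝ => φ.displacement ((s : T) + (t : T))) 0
    have h1 : HasDerivAt (fun t : ℝ => φ.displacement ((s + t : ℝ) : T)) (f' (s : T)) 0 := by
      have h2 := hf'.hasDerivAt (s + 0)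
      have h3 := h2.scomp_of_eq (0 : ℝ) ((hasDerivAt_id (0 : ℝ)).const_add s) rfl
      rw [one_smul, add_zero] at h3
      exact h3
    simp only [AddCircle.coe_add] at h1
    rw [h1.deriv]
  · exact ((memSob_of_const 1 _).add hfs' :)

/-- The composition theorem in `H^q`. -/
theorem exists_energy_comp_le_self {q : ℝ} (hq : 3 / 2 < q) (M : ℝ) {E : ℝ≥0∞} (hE : E ≠ ⊤) :
    ∃ R : ℝ≥0∞, R ≠ ⊤ ∧ ∀ φ : CircleDiffeo, φ.JacBound M →
      energy (q - 1) φ.jac ≤ E → ∀ u : T → ℝ, MemSob q u →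
        energy q (fun x => u (φ.toFun x)) ≤ R * energy q u ∧
        energy q (fun x => u (φ.inv x)) ≤ R * energy q u := by
  obtain ⟨N, hN⟩ := exists_nat_gt q
  exact exists_energy_comp_le hq M hE N q (by linarith) le_rfl (by linarith)

theorem CircleDiffeo.memSob_comp {q : ℝ} (hq : 3 / 2 < q) (φ : CircleDiffeo)
    (hφ : MemSob (q - 1) φ.jac) {u : T → ℝ} (hu : MemSob q u) :
    MemSob q (fun x => u (φ.toFun x)) ∧ MemSob q (fun x => u (φ.inv x)) := by
  obtain ⟨M, hM⟩ := φ.exists_jacBound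
  obtain ⟨R, hR, h⟩ := exists_energy_comp_le_self hq M (memSob_iff.1 hφ).2
  obtain ⟨h1, h2⟩ := h φ hM le_rfl u hu
  have hu' := memSob_iff.1 hu
  exact ⟨memSob_iff.2 ⟨φ.memLp_comp hu'.1, ne_top_of_le_ne_top (ENNReal.mul_ne_top hR hu'.2) h1⟩,
    memSob_iff.2 ⟨φ.symm.memLp_comp hu'.1, ne_top_of_le_ne_top (ENNReal.mul_ne_top hR hu'.2) h2⟩⟩

/-- A `C¹` diffeomorphism whose displacement is of class `H^q` belongs to `D^q`. -/
theorem CircleDiffeo.exists_D {q : ℝ} (hq : 3 / 2 < q) (φ : CircleDiffeo) (h : MemSob q φ.disp) :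
    ∃ ψ : D q, ψ.toHomeo = φ.homeo := by
  have hj : MemSob (q - 1) φ.jac :=
    (memSob_of_const 1 _).add (φ.isC1.isWeakDeriv.memSob_deriv h)
  refine ⟨⟨φ.homeo, ⟨φ.disp, φ.isDisplacement, h⟩, ⟨φ.symm.disp, φ.symm.isDisplacement, ?_⟩⟩, rfl⟩
  have h1 := ((φ.memSob_comp hq hj h).2).const_mul (-1)
  simp only [neg_one_mul] at h1
  exact h1

theorem CircleDiffeo.coeff_comp_inv (φ : CircleDiffeo) (w : T → ℝ) (n : ℤ) :
    coeff (fun x => w (φ.inv x)) n =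
      ∫ x, (w x : ℂ) * (fourier (-n) (φ.toFun x) * (φ.jac x : ℂ)) ∂haar := by
  rw [coeff, fourierCoeff, ← φ.integral_jac_smul_comp]
  refine integral_congr_ae (Filter.Eventually.of_forall fun x => ?_)
  simp only [φ.left_inv, smul_eq_mul]
  ring

/-! ### The derivative of a conjugate at the identity -/

theorem integrable_mul_continuousMap {w : T → ℝ} (hw : MemLp w 2 haar) (G : C(T, ℂ)) :
    Integrable (fun x => (w x : ℂ) * G x) haar :=
  (hw.integrable (by norm_num)).ofReal.mul_of_top_left
    ((map_continuous G).memLp_of_hasCompactSupport (HasCompactSupport.of_compactSpace G))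

theorem norm_integral_mul_le {σ : ℝ} (hσ : 0 ≤ σ) (w : H σ) (G : C(T, ℂ)) :
    ‖∫ x, (w x : ℂ) * G x ∂haar‖ ≤ ‖w‖ * ‖G‖ := by
  have hw : MemLp (w : T → ℝ) 2 haar := Lp.memLp w.1
  have h1 : ∫⁻ x, ‖w x‖ₑ ∂haar ≤ ENNReal.ofReal ‖w‖ := by
    have h2 := eLpNorm_le_eLpNorm_of_exponent_le (p := 1) (q := 2) (by norm_num) hw.1
    rw [eLpNorm_one_eq_lintegral_enorm] at h2
    refine h2.trans ?_
    rw [eLpNorm_eq_lintegral_rpow_enorm_toReal (by norm_num) (by norm_num)]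
    simp only [ENNReal.toReal_ofNat, ENNReal.rpow_ofNat]
    rw [← energy_zero hw, ← ENNReal.rpow_le_rpow_iff (z := 2) (by norm_num), ← ENNReal.rpow_mul]
    rw [show (1 / 2 : ℝ) * 2 = 1 by norm_num, ENNReal.rpow_one, ENNReal.rpow_two,
      ← ENNReal.ofReal_pow (norm_nonneg _), ofReal_norm_sq]
    exact energy_mono hσ _
  have h3 : ‖∫ x, (w x : ℂ) * G x ∂haar‖ₑ ≤ ENNReal.ofReal (‖w‖ * ‖G‖) := by
    refine (enorm_integral_le_lintegral_enorm _).trans ?_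
    rw [ENNReal.ofReal_mul (norm_nonneg _)]
    calc _ ≤ ∫⁻ x, ‖w x‖ₑ * ENNReal.ofReal ‖G‖ ∂haar := by
          refine lintegral_mono fun x => ?_
          simp only
          rw [enorm_mul, enorm_ofReal, ← ofReal_norm (G x)]
          gcongr
          exact G.norm_coe_le_norm x
      _ ≤ _ := by
          rw [lintegral_mul_const' _ _ (by simp)]
          gcongr
  rw [← ofReal_norm] at h3
  exact (ENNReal.ofReal_le_ofReal_iff (by positivity)).1 h3

/-- The pairing `(w, G) ↦ ∫ w G` of `H^σ` with continuous functions. -/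
def pairing {σ : ℝ} (hσ : 0 ≤ σ) : H σ →L[ℝ] C(T, ℂ) →L[ℝ] ℂ :=
  LinearMap.mkContinuous₂
    (LinearMap.mk₂ ℝ (fun (w : H σ) (G : C(T, ℂ)) => ∫ x, (w x : ℂ) * G x ∂haar)
      (fun w w' G => by
        rw [← integral_add (integrable_mul_continuousMap (Lp.memLp w.1) G)
          (integrable_mul_continuousMap (Lp.memLp w'.1) G)]
        refine integral_congr_ae ?_
        filter_upwards [Lp.coeFn_add w.1 w'.1] with x hx
        change ((((w.1 + w'.1 : Lp ℝ 2 haar) : T → ℝ) x : ℝ) : ℂ) * G x = _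
        rw [hx, Pi.add_apply, Complex.ofReal_add, add_mul])
      (fun c w G => by
        rw [← integral_smul]
        refine integral_congr_ae ?_
        filter_upwards [Lp.coeFn_smul c w.1] with x hx
        change ((((c • w.1 : Lp ℝ 2 haar) : T → ℝ) x : ℝ) : ℂ) * G x = _
        rw [hx, Pi.smul_apply, smul_eq_mul, Complex.ofReal_mul, Complex.real_smul, mul_assoc])
      (fun w G G' => by
        rw [← integral_add (integrable_mul_continuousMap (Lp.memLp w.1) G)
          (integrable_mul_continuousMap (Lp.memLp w.1) G')]
        refine integral_congr_ae (Filter.Eventually.of_forall fun x => ?_)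
        simp only [ContinuousMap.add_apply, mul_add])
      (fun c w G => by
        rw [← integral_smul]
        refine integral_congr_ae (Filter.Eventually.of_forall fun x => ?_)
        simp only [ContinuousMap.smul_apply, Complex.real_smul]
        ring)) 1
    (fun w G => by rw [one_mul]; exact norm_integral_mul_le hσ w G)

theorem pairing_apply {σ : ℝ} (hσ : 0 ≤ σ) (w : H σ) (G : C(T, ℂ)) :
    pairing hσ w G = ∫ x, (w x : ℂ) * G x ∂haar := rfl

/-- The curve `t ↦ exp (-i n (x + t f)) (1 + t f')` of continuous functions. -/
def testCurve (n : ℤ) (f f' : C(T, ℂ)) (t : ℝ) : C(T, ℂ) :=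
  fourier (-n) * (NormedSpace.exp (t • ((-Complex.I * n) • f)) * (1 + t • f'))

theorem hasDerivAt_testCurve (n : ℤ) (f f' : C(T, ℂ)) :
    HasDerivAt (testCurve n f f') (fourier (-n) * ((-Complex.I * n) • f + f')) 0 := by
  have h1 := hasDerivAt_exp_smul_const (𝕂 := ℝ) ((-Complex.I * n) • f) (0 : ℝ)
  have h2 : HasDerivAt (fun t : ℝ => (1 : C(T, ℂ)) + t • f') f' 0 := by
    have := ((hasDerivAt_id (0 : ℝ)).smul_const f').const_add (1 : C(T, ℂ))
    simpa using this
  have h3 := (h1.mul h2).const_mul (fourier (-n) : C(T, ℂ))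
  refine HasDerivAt.congr_deriv h3 ?_
  simp

theorem testCurve_zero (n : ℤ) (f f' : C(T, ℂ)) : testCurve n f f' 0 = fourier (-n) := by
  simp [testCurve]

theorem testCurve_apply (n : ℤ) {f f' : T → ℝ} (hf : Continuous f) (hf' : Continuous f') (t : ℝ)
    (x : T) : testCurve n ⟨fun x => (f x : ℂ), Complex.continuous_ofReal.comp hf⟩
      ⟨fun x => (f' x : ℂ), Complex.continuous_ofReal.comp hf'⟩ t x =
      fourier (-n) (x + ((t * f x : ℝ) : T)) * ((1 + t * f' x : ℝ) : ℂ) := by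
  have h1 : ∀ A : C(T, ℂ), (NormedSpace.exp A) x = Complex.exp (A x) := fun A => by
    rw [Complex.exp_eq_exp_ℂ]
    exact NormedSpace.map_exp ((Pi.evalRingHom (fun _ : T => ℂ) x).comp ContinuousMap.coeFnRingHom)
      (continuous_eval_const x) A
  have h2 : (fourier (-n) (x + ((t * f x : ℝ) : T)) : ℂ) =
      fourier (-n) x * Complex.exp (-Complex.I * n * (t * f x)) := by
    have h3 : (fourier (-n) (x + ((t * f x : ℝ) : T)) : ℂ) =
        fourier (-n) x * fourier (-n) ((t * f x : ℝ) : T) := by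
      simp only [fourier_apply, smul_add, toCircle_add, Circle.coe_mul]
    rw [h3, fourier_coe_apply]
    congr 2
    have : (Real.pi : ℂ) ≠ 0 := by exact_mod_cast Real.pi_ne_zero
    push_cast
    field_simp
  rw [h2, testCurve, ContinuousMap.mul_apply, ContinuousMap.mul_apply, h1]
  simp only [ContinuousMap.smul_apply, ContinuousMap.add_apply, ContinuousMap.one_apply,
    ContinuousMap.coe_mk, smul_eq_mul, Complex.real_smul]
  push_cast
  ring_nf

theorem eventually_mem_chartDomain {q : ℝ} (hq : 3 / 2 < q) (u : H q) {f f' : T → ℝ}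
    (hf : IsC1 f f') (hfu : f =ᵐ[haar] u) :
    ∀ᶠ t : ℝ in nhds 0, ∃ Φ : CircleDiffeo, (Φ.disp = fun x => t * f x) ∧
      (Φ.disp' = fun x => t * f' x) ∧ ∃ φ : D q, φ.toHomeo = Φ.homeo ∧ IsChart (t • u) φ := by
  obtain ⟨M, hM⟩ := exists_bound_of_continuous hf.continuous_deriv
  have hlim : Filter.Tendsto (fun t : ℝ => |t| * (|M| + 1)) (nhds 0) (nhds 0) := by
    have : Continuous fun t : ℝ => |t| * (|M| + 1) := by fun_prop
    simpa using this.tendsto 0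
  filter_upwards [hlim.eventually (gt_mem_nhds one_pos)] with t ht
  have hC1 : IsC1 (fun x => t * f x) fun x => t * f' x :=
    ⟨fun s => (hf.hasDerivAt s).const_mul t, continuous_const.mul hf.continuous_deriv⟩
  have hpos : ∀ x, 0 < 1 + t * f' x := fun x => by
    have h1 : |t * f' x| ≤ |t| * (|M| + 1) := by
      rw [abs_mul]
      gcongr
      linarith [hM x, le_abs_self M]
    linarith [neg_abs_le (t * f' x)]
  obtain ⟨Φ, h1, h2⟩ := exists_circleDiffeo hC1 hpos
  have hs : MemSob q Φ.disp := by
    rw [h1]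
    exact (memSob_congr hfu.symm (sobolev_memSob u)).const_mul t
  obtain ⟨φ, hφ⟩ := Φ.exists_D hq hs
  refine ⟨Φ, h1, h2, φ, hφ, ?_⟩
  have h3 := Lp.coeFn_smul t u.1
  filter_upwards [h3, hfu] with x hx hx'
  have h4 : ((t • u : H q) : T → ℝ) x = t * f x := by
    change ((t • u.1 : Lp ℝ 2 haar) : T → ℝ) x = _
    rw [hx, hx']
    rfl
  rw [h4, hφ]
  change Φ.toFun x = _
  rw [Φ.apply_eq, h1]

/-- The derivative of the test functions `exp (-i n φ) φ_x` in the direction `f`, tested against `w`. -/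
theorem integral_mul_deriv_testCurve {f f' w : T → ℝ} (hf : IsC1 f f') (hw : MemLp w 2 haar) (n : ℤ) :
    ∫ x, (w x : ℂ) * (fourier (-n) x * (-Complex.I * n * f x + f' x)) ∂haar =
      -conv (coeff f) (dx (coeff w)) n := by
  have mf := memLp_of_continuous hf.continuous
  have mf' := memLp_of_continuous hf.continuous_deriv
  have i1 : Integrable (fun x => fourier (-n) x • ((f x * w x : ℝ) : ℂ)) haar :=
    (((mf.integrable_mul hw).ofReal).fourier_smul _)
  have i2 : Integrable (fun x => fourier (-n) x • ((f' x * w x : ℝ) : ℂ)) haar :=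
    (((mf'.integrable_mul hw).ofReal).fourier_smul _)
  have h1 : ∫ x, (w x : ℂ) * (fourier (-n) x * (-Complex.I * n * f x + f' x)) ∂haar =
      -Complex.I * n * coeff (fun x => f x * w x) n + coeff (fun x => f' x * w x) n := by
    rw [coeff, coeff, fourierCoeff, fourierCoeff, ← integral_const_mul, ← integral_add (i1.const_mul _) i2]
    refine integral_congr_ae (Filter.Eventually.of_forall fun x => ?_)
    simp only [smul_eq_mul]
    push_cast
    ring
  have h2 := ((hasSum_coeff_mul mf hw n).mul_left (-Complex.I * n)).add (hasSum_coeff_mul mf' hw n)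
  have e : ∀ m, -Complex.I * n * (coeff f (n - m) * coeff w m) + coeff f' (n - m) * coeff w m =
      -(coeff f (n - m) * dx (coeff w) m) := fun m => by
    rw [hf.isWeakDeriv.coeff_eq, dx, dx]
    push_cast
    ring
  simp only [e] at h2
  rw [h1, ← h2.tsum_eq, tsum_neg, conv]

theorem pairing_fourier {σ : ℝ} (hσ : 0 ≤ σ) (w : H σ) (n : ℤ) :
    pairing hσ w (fourier (-n)) = coeff w n := by
  rw [pairing_apply, coeff, fourierCoeff]
  refine integral_congr_ae (Filter.Eventually.of_forall fun x => ?_)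
  simp only [smul_eq_mul]
  ring

/-- A continuous real function as a continuous complex function. -/
def toComplex {f : T → ℝ} (hf : Continuous f) : C(T, ℂ) :=
  ⟨fun x => (f x : ℂ), Complex.continuous_ofReal.comp hf⟩

theorem pairing_deriv_testCurve {σ : ℝ} (hσ : 0 ≤ σ) (w : H σ) {f f' : T → ℝ} (hf : IsC1 f f')
    (n : ℤ) : pairing hσ w (fourier (-n) *
      ((-Complex.I * n) • toComplex hf.continuous + toComplex hf.continuous_deriv)) =
        -conv (coeff f) (dx (coeff w)) n := by
  rw [pairing_apply, ← integral_mul_deriv_testCurve hf (Lp.memLp w.1)]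
  rfl

/-- The identity `A_φ u ∘ φ⁻¹ = A (u ∘ φ⁻¹)` along the ray `φ = id + t u`, after a change of
variables which removes `φ⁻¹`. -/
theorem eventually_pairing_conjugate {a : ℤ → ℝ} {r q : ℝ} (hq : 3 / 2 < q) (hσ : 0 ≤ q - r)
    (hq0 : 0 ≤ q) {L : H q → (H q →L[ℝ] H (q - r))}
    (hconj : ∀ (f : H q) (φ : D q), IsChart f φ → ∀ v : H q, IsConjugate a φ v (L f v)) (u : H q)
    {f f' : T → ℝ} (hf : IsC1 f f') (hfu : f =ᵐ[haar] u) (n : ℤ) :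
    ∀ᶠ t : ℝ in nhds 0, pairing hσ (L (t • u) u)
        (testCurve n (toComplex hf.continuous) (toComplex hf.continuous_deriv) t) =
      (a n : ℂ) * pairing hq0 u
        (testCurve n (toComplex hf.continuous) (toComplex hf.continuous_deriv) t) := by
  filter_upwards [eventually_mem_chartDomain hq u hf hfu] with t ht
  obtain ⟨Φ, h1, h2, φ, hφ, hφc⟩ := ht
  have h3 := hconj _ φ hφc u n
  have e : ∀ x, testCurve n (toComplex hf.continuous) (toComplex hf.continuous_deriv) t x =
      fourier (-n) (Φ.toFun x) * (Φ.jac x : ℂ) := fun x => by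
    rw [toComplex, toComplex, testCurve_apply n hf.continuous hf.continuous_deriv, Φ.apply_eq,
      CircleDiffeo.jac, h1, h2]
  rw [hφ] at h3
  rw [pairing_apply, pairing_apply]
  simp only [e]
  rw [← Φ.coeff_comp_inv, ← Φ.coeff_comp_inv]
  exact h3

theorem hasDerivAt_bilinear {E F G : Type*} [NormedAddCommGroup E] [NormedSpace ℝ E]
    [NormedAddCommGroup F] [NormedSpace ℝ F] [NormedAddCommGroup G] [NormedSpace ℝ G]
    (B : E →L[ℝ] F →L[ℝ] G) {c : ℝ → E} {c' : E} {d : ℝ → F} {d' : F} {t : ℝ}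
    (hc : HasDerivAt c c' t) (hd : HasDerivAt d d' t) :
    HasDerivAt (fun s => B (c s) (d s)) (B c' (d t) + B (c t) d') t :=
  (B.hasFDerivAt.comp_hasDerivAt t hc).clm_apply hd

/-- The derivative of `φ ↦ A_φ` at the identity is a commutator: applied to `u` in the direction `u`
it is `u A u_x - A (u u_x)`. -/
theorem coeff_derivative_conjugate {a : ℤ → ℝ} {r q : ℝ} (hq : 3 / 2 < q) (hrq : r ≤ q)
    {L : H q → (H q →L[ℝ] H (q - r))} {L' : H q →L[ℝ] (H q →L[ℝ] H (q - r))}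
    (hL : HasFDerivWithinAt L L' (chartDomain q) 0)
    (hconj : ∀ (f : H q) (φ : D q), IsChart f φ → ∀ v : H q, IsConjugate a φ v (L f v)) (u : H q) :
    coeff (L 0 u) = mult a (coeff u) ∧ ∀ n, coeff (L' u u) n =
      conv (coeff u) (mult a (dx (coeff u))) n - a n * conv (coeff u) (dx (coeff u)) n := by
  obtain ⟨f, f', hf, hfu, -⟩ := (sobolev_memSob u).exists_isC1 hq
  have hσ : 0 ≤ q - r := sub_nonneg.2 hrq
  have hq0 : 0 ≤ q := by linarith
  have hcf : coeff f = coeff u := coeff_congr hfu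
  have hid := eventually_pairing_conjugate hq hσ hq0 hconj u hf hfu
  have h0 : coeff (L 0 u) = mult a (coeff u) := by
    funext n
    have h1 := (hid n).self_of_nhds
    rw [zero_smul, testCurve_zero, pairing_fourier, pairing_fourier] at h1
    exact h1
  refine ⟨h0, fun n => ?_⟩
  have dray : HasDerivAt (fun t : ℝ => t • u) u 0 := by
    have h1 := (hasDerivAt_id (0 : ℝ)).smul_const u
    rw [one_smul] at h1
    exact h1
  have dL : HasDerivAt (fun t : ℝ => L (t • u)) (L' u) 0 :=
    hL.comp_hasDerivAt_of_eq 0 dray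
      ((eventually_mem_chartDomain hq u hf hfu).mono fun t ⟨_, _, _, φ, _, hφ⟩ => ⟨φ, hφ⟩)
      (zero_smul ℝ u).symm
  have dLu : HasDerivAt (fun t : ℝ => L (t • u) u) (L' u u) 0 :=
    (ContinuousLinearMap.apply ℝ (H (q - r)) u).hasFDerivAt.comp_hasDerivAt (0 : ℝ) dL
  have dG := hasDerivAt_testCurve n (toComplex hf.continuous) (toComplex hf.continuous_deriv)
  have d1 := hasDerivAt_bilinear (pairing hσ) dLu dG
  have d2 := (hasDerivAt_bilinear (pairing hq0) (hasDerivAt_const (0 : ℝ) u) dG).const_mul (a n : ℂ)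
  have d3 := d1.unique (d2.congr_of_eventuallyEq (hid n))
  rw [zero_smul, testCurve_zero, map_zero, zero_apply, zero_add, pairing_fourier,
    pairing_deriv_testCurve hσ _ hf, pairing_deriv_testCurve hq0 _ hf, h0, hcf] at d3
  have hcomm : dx (mult a (coeff u)) = mult a (dx (coeff u)) := by
    funext m
    simp only [dx, mult]
    ring
  rw [hcomm] at d3
  linear_combination d3

/-- The quadratic map `S` is bounded on `H^q`. -/
theorem exists_quadCoeff_bound {a : ℤ → ℝ} {r q : ℝ} (ha : IsInertia a r) (hq : 3 / 2 < q)
    (hrq : r ≤ q) : ∃ K : ℝ≥0∞, K ≠ ⊤ ∧ ∀ u : T → ℝ, MemSob q u → ∃ s : T → ℝ, MemSob q s ∧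
      coeff s = quadCoeff a (coeff u) ∧ energy q s ≤ K * energy q u ^ 2 := by
  have hr := ha.one_le
  obtain ⟨L, hLs, hconj⟩ := ha.smooth q hq hrq
  have h0mem : (0 : H q) ∈ chartDomain q := by
    obtain ⟨f, f', hf, hfu, -⟩ := (sobolev_memSob (0 : H q)).exists_isC1 hq
    obtain ⟨_, _, _, φ, _, hφ⟩ := (eventually_mem_chartDomain hq 0 hf hfu).self_of_nhds
    rw [zero_smul] at hφ
    exact ⟨φ, hφ⟩
  have hL := ((hLs.differentiableOn (by simp)) 0 h0mem).hasFDerivWithinAt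
  set L' := fderivWithin ℝ L (chartDomain q) 0
  obtain ⟨C, hC⟩ := ha.order_inv
  obtain ⟨K, hK, hKb⟩ := exists_energy_mul_le (σ := q - r) (τ := q - 1) (by linarith) (by linarith)
    (by linarith)
  refine ⟨ENNReal.ofReal (C ^ 2) * (2 * (ENNReal.ofReal (‖L'‖ ^ 2) +
    4 * (K * ENNReal.ofReal (‖L 0‖ ^ 2)))), by finiteness, fun u₀ hu₀ => ?_⟩
  obtain ⟨u, hu⟩ := hu₀.exists_sobolev
  obtain ⟨h1, h2⟩ := coeff_derivative_conjugate hq hrq hL hconj u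
  obtain ⟨f, f', hf, hfu, hfs⟩ := (sobolev_memSob u).exists_isC1 hq
  rw [← coeff_congr hu, ← energy_congr hu]
  -- `z` is the function `[A, u] u_x - 2 (A u) u_x`
  set y : T → ℝ := fun x => L 0 u x * f' x with hy
  have my : MemSob (q - r) y :=
    (sobolev_memSob (L 0 u)).mul (by linarith) (by linarith) (by linarith) hfs hf.continuous_deriv
  have mB : MemSob (q - r) (L' u u) := sobolev_memSob _
  set z : T → ℝ := fun x => -1 * L' u u x + -2 * y x with hz
  have mz : MemSob (q - r) z := (mB.const_mul (-1)).add (my.const_mul (-2))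
  have hzc : ∀ n, coeff z n = -coeff (L' u u) n - 2 * coeff y n := fun n => by
    rw [hz, coeff_add_fun (mB.const_mul (-1)).1 (my.const_mul (-2)).1, coeff_const_mul, coeff_const_mul]
    push_cast
    ring
  have hyc : coeff y = conv (mult a (coeff u)) (dx (coeff u)) := by
    rw [hy, ← conv_coeff (sobolev_memSob (L 0 u)).1 (memLp_of_continuous hf.continuous_deriv), h1,
      hf.isWeakDeriv.coeff_eq, coeff_congr hfu]
  have hquad : quadCoeff a (coeff u) = fun n => (((a n)⁻¹ : ℝ) : ℂ) * coeff z n := by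
    funext n
    rw [hzc, hyc, h2]
    change (((a n)⁻¹ : ℝ) : ℂ) * ((a n : ℂ) * conv (coeff u) (dx (coeff u)) n -
      conv (coeff u) (mult a (dx (coeff u))) n -
      2 • conv (mult a (coeff u)) (dx (coeff u)) n) = _
    rw [two_nsmul]
    ring
  have hzE : energy (q - r) z ≤ 2 * (ENNReal.ofReal (‖L'‖ ^ 2) +
      4 * (K * ENNReal.ofReal (‖L 0‖ ^ 2))) * energy q u ^ 2 := by
    have hB : energy (q - r) (L' u u) ≤ ENNReal.ofReal (‖L'‖ ^ 2) * energy q u ^ 2 := by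
      rw [← ofReal_norm_sq, ← ofReal_norm_sq, ← ENNReal.ofReal_pow (by positivity),
        ← ENNReal.ofReal_mul (by positivity)]
      refine ENNReal.ofReal_le_ofReal ?_
      calc ‖L' u u‖ ^ 2 ≤ (‖L'‖ * ‖u‖ * ‖u‖) ^ 2 := by
            gcongr
            exact L'.le_opNorm₂ u u
        _ = _ := by ring
    have hA : energy (q - r) (L 0 u) ≤ ENNReal.ofReal (‖L 0‖ ^ 2) * energy q u := by
      rw [← ofReal_norm_sq, ← ofReal_norm_sq, ← ENNReal.ofReal_mul (by positivity), ← mul_pow]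
      gcongr
      exact (L 0).le_opNorm u
    have hf'E : energy (q - 1) f' ≤ energy q u := by
      rw [← energy_congr hfu, energy_of_coeff_eq_dx hf.isWeakDeriv.coeff_eq q]
      exact le_add_self
    have hyE : energy (q - r) y ≤ K * ENNReal.ofReal (‖L 0‖ ^ 2) * energy q u ^ 2 := by
      refine (hKb _ _ (sobolev_memSob (L 0 u)).1 (memLp_of_continuous hf.continuous_deriv)).trans ?_
      calc _ ≤ K * (ENNReal.ofReal (‖L 0‖ ^ 2) * energy q u * energy q u) := by gcongr
        _ = _ := by ring
    refine (energy_add_le _ (mB.const_mul (-1)).1 (my.const_mul (-2)).1).trans ?_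
    rw [energy_const_mul, energy_const_mul]
    have e1 : ENNReal.ofReal ((-1) ^ 2) = 1 := by norm_num
    have e4 : ENNReal.ofReal ((-2) ^ 2) = 4 := by norm_num
    rw [e1, e4, one_mul]
    calc _ ≤ 2 * (ENNReal.ofReal (‖L'‖ ^ 2) * energy q u ^ 2 +
          4 * (K * ENNReal.ofReal (‖L 0‖ ^ 2) * energy q u ^ 2)) := by gcongr
      _ = _ := by ring
  -- `A⁻¹` gains `r` derivatives.
  have hterm : ∀ n, wt q n * ‖(((a n)⁻¹ : ℝ) : ℂ) * coeff z n‖ₑ ^ 2 ≤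
      ENNReal.ofReal (C ^ 2) * (wt (q - r) n * ‖coeff z n‖ₑ ^ 2) := fun n => by
    have h3 : ‖(((a n)⁻¹ : ℝ) : ℂ)‖ₑ ^ 2 ≤ ENNReal.ofReal (C ^ 2) * wt (-r) n := by
      rw [enorm_sq_eq_ofReal, Complex.norm_real, wt, ← ENNReal.ofReal_mul (by positivity)]
      refine ENNReal.ofReal_le_ofReal ?_
      have h4 := pow_le_pow_left₀ (abs_nonneg _) (hC n) 2
      rw [mul_pow, ← Real.rpow_natCast ((1 + (n : ℝ) ^ 2) ^ (-r / 2)), ← Real.rpow_mul (by positivity)] at h4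
      norm_num at h4
      simpa using h4
    calc _ = wt q n * (‖(((a n)⁻¹ : ℝ) : ℂ)‖ₑ ^ 2 * ‖coeff z n‖ₑ ^ 2) := by rw [enorm_mul, mul_pow]
      _ ≤ wt q n * (ENNReal.ofReal (C ^ 2) * wt (-r) n * ‖coeff z n‖ₑ ^ 2) := by gcongr
      _ = ENNReal.ofReal (C ^ 2) * (wt q n * wt (-r) n * ‖coeff z n‖ₑ ^ 2) := by ring
      _ = _ := by rw [wt_mul, sub_eq_add_neg]
  have hsE : ∑' n, wt q n * ‖(((a n)⁻¹ : ℝ) : ℂ) * coeff z n‖ₑ ^ 2 ≤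
      ENNReal.ofReal (C ^ 2) * energy (q - r) z := by
    rw [energy_eq, ← ENNReal.tsum_mul_left]
    exact ENNReal.tsum_le_tsum hterm
  have hfin : ∑' n, wt q n * ‖(((a n)⁻¹ : ℝ) : ℂ) * coeff z n‖ₑ ^ 2 ≠ ⊤ :=
    ne_top_of_le_ne_top (ENNReal.mul_ne_top (by simp) (memSob_iff.1 mz).2) hsE
  obtain ⟨s, hs, hsc⟩ := exists_coeff_eq (c := fun n => (((a n)⁻¹ : ℝ) : ℂ) * coeff z n)
    (fun n => by rw [ha.even, coeff_neg_index, map_mul, Complex.conj_ofReal])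
    (by
      have h3 : ∑' n, ‖(((a n)⁻¹ : ℝ) : ℂ) * coeff z n‖ₑ ^ 2 ≠ ⊤ := by
        refine ne_top_of_le_ne_top hfin (ENNReal.tsum_le_tsum fun n => ?_)
        refine le_mul_of_one_le_left (by simp) ?_
        rw [wt, ← ENNReal.ofReal_one]
        exact ENNReal.ofReal_le_ofReal (Real.one_le_rpow (one_le_weight n) (by linarith))
      simpa using ENNReal.summable_toReal h3)
  have hse : energy q s ≤ ENNReal.ofReal (C ^ 2) * energy (q - r) z := by
    rw [energy_eq, hsc]
    exact hsE
  refine ⟨s, memSob_iff.2 ⟨hs, ?_⟩, by rw [hsc, hquad], hse.trans ?_⟩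
  · rw [energy_eq, hsc]
    exact hfin
  · rw [mul_assoc]
    gcongr

/-! ### The spray -/

/-- Uniform bounds on a set of diffeomorphisms which is bounded for `d_q`. -/
theorem exists_bounds_of_dq_le {q : ℝ} (hq : 3 / 2 < q) (φ₀ : D q) (C : ℝ) :
    ∃ (M : ℝ) (E : ℝ≥0∞), E ≠ ⊤ ∧ ∀ φ : D q, dq φ φ₀ ≤ C → ∀ Φ : CircleDiffeo, Φ.jac = φ.deriv →
      MemSob (q - 1) Φ.jac → Φ.JacBound M ∧ energy (q - 1) Φ.jac ≤ E := by
  obtain ⟨Φ₀, -, -, hj₀, hs₀⟩ := φ₀.exists_circleDiffeo hq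
  obtain ⟨M₀, hM₀⟩ := Φ₀.exists_jacBound
  set E : ℝ≥0∞ := 2 * (ENNReal.ofReal (C ^ 2) + energy (q - 1) Φ₀.jac) with hE
  have hE' : E ≠ ⊤ := by
    have := (memSob_iff.1 hs₀).2
    finiteness
  set Λ : ℝ≥0∞ := (∑' n, wt (-(q - 1)) n) * E with hΛ
  have hΛ' : Λ ≠ ⊤ := ENNReal.mul_ne_top (tsum_wt_ne_top (by linarith)) hE'
  refine ⟨max (Real.sqrt Λ.toReal) (C + M₀), E, hE', fun φ hφ Φ hj hs => ?_⟩
  -- The three terms of `d_q` are nonnegative, so each of the last two is at most `C`.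
  have n1 : 0 ≤ ⨆ x : T, ‖((toCircle (φ₀.toHomeo x) : Circle) : ℂ) -
      ((toCircle (φ.toHomeo x) : Circle) : ℂ)‖ := Real.iSup_nonneg fun x => norm_nonneg _
  have n2 := sobNorm_nonneg (q - 1) fun x => φ.deriv x - φ₀.deriv x
  have n3 : 0 ≤ ⨆ x : T, |1 / φ.deriv x - 1 / φ₀.deriv x| := Real.iSup_nonneg fun x => abs_nonneg _
  rw [dq] at hφ
  have hC0 : 0 ≤ C := by linarith
  have md : MemSob (q - 1) fun x => φ.deriv x - φ₀.deriv x := by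
    rw [← hj, ← hj₀]
    simpa only [neg_one_mul, ← sub_eq_add_neg] using hs.add (hs₀.const_mul (-1))
  have hen : energy (q - 1) Φ.jac ≤ E := by
    have h1 := energy_add_le (q - 1) md.1 hs₀.1
    have e : (fun x => φ.deriv x - φ₀.deriv x + Φ₀.jac x) = Φ.jac := by
      funext x
      rw [hj₀, hj]
      ring
    rw [e, ← md.ofReal_sobNorm_sq] at h1
    refine h1.trans ?_
    rw [hE]
    gcongr
    linarith
  refine ⟨fun x => ⟨le_max_of_le_left ?_, le_max_of_le_right ?_⟩, hen⟩
  · have h1 := (hs.enorm_sq_le (by linarith) Φ.continuous_jac x).trans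
      (show _ ≤ Λ by rw [hΛ]; gcongr)
    refine Real.le_sqrt_of_sq_le ?_
    rw [Real.enorm_eq_ofReal (Φ.jac_pos x).le, ← ENNReal.ofReal_pow (Φ.jac_pos x).le] at h1
    exact (ENNReal.ofReal_le_iff_le_toReal hΛ').1 h1
  · have hc : Continuous fun x => |1 / φ.deriv x - 1 / φ₀.deriv x| := by
      rw [← hj, ← hj₀]
      simp only [one_div]
      exact ((Φ.continuous_jac.inv₀ fun x => (Φ.jac_pos x).ne').sub
        (Φ₀.continuous_jac.inv₀ fun x => (Φ₀.jac_pos x).ne')).abs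
    have h1 := le_ciSup (isCompact_range hc).bddAbove x
    have h2 : |1 / φ.deriv x - 1 / φ₀.deriv x| ≤ C := h1.trans (by linarith)
    rw [← hj, ← hj₀, one_div, one_div] at h2
    linarith [le_abs_self ((Φ.jac x)⁻¹ - (Φ₀.jac x)⁻¹), (hM₀ x).2]

theorem IsAcceleration.unique {a : ℤ → ℝ} {q : ℝ} (hq : 3 / 2 < q) {φ : D q} {v w w' : H q}
    (h : IsAcceleration a φ v w) (h' : IsAcceleration a φ v w') : w = w' := by
  obtain ⟨Φ, h1, h2, -, -⟩ := φ.exists_circleDiffeo hq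
  rw [IsAcceleration, ← h2] at h h'
  have h3 := ae_eq_of_coeff_eq (Φ.symm.memLp_comp (Lp.memLp w.1)) (Φ.symm.memLp_comp (Lp.memLp w'.1))
    (h.trans h'.symm)
  have h4 := Φ.comp_ae_eq h3
  refine sobolev_ext ?_
  filter_upwards [h4] with x hx
  have h5 : Φ.symm.toFun (Φ.toFun x) = x := Φ.left_inv x
  rwa [h5] at hx

/-- `S_φ(v) = S(v ∘ φ⁻¹) ∘ φ` is of class `H^q`, and its norm is controlled by the norm of `v` and
by the bounds on `φ`. -/
theorem exists_isAcceleration_bound {a : ℤ → ℝ} {r q : ℝ} (ha : IsInertia a r) (hq : 3 / 2 < q)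
    (hrq : r ≤ q) (M : ℝ) {E : ℝ≥0∞} (hE : E ≠ ⊤) :
    ∃ K : ℝ≥0∞, K ≠ ⊤ ∧ ∀ (φ : D q) (Φ : CircleDiffeo), Φ.toFun = φ.toHomeo →
      Φ.inv = φ.toHomeo.symm → Φ.JacBound M → MemSob (q - 1) Φ.jac → energy (q - 1) Φ.jac ≤ E →
      ∀ v : H q, ∃ w : H q, IsAcceleration a φ v w ∧ energy q w ≤ K * energy q v ^ 2 := by
  obtain ⟨K, hK, hKb⟩ := exists_quadCoeff_bound ha hq hrq
  obtain ⟨R, hR, hRb⟩ := exists_energy_comp_le_self hq M hE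
  refine ⟨R * (K * R ^ 2), by finiteness, fun φ Φ h1 h2 hM hs hEb v => ?_⟩
  have hv : MemSob q fun x => v (Φ.inv x) := (Φ.memSob_comp hq hs (sobolev_memSob v)).2
  obtain ⟨s, hss, hsc, hsE⟩ := hKb _ hv
  obtain ⟨w, hw⟩ := (Φ.memSob_comp hq hs hss).1.exists_sobolev
  refine ⟨w, ?_, ?_⟩
  · have h3 := Φ.symm.comp_ae_eq hw
    have e : (fun x => s (Φ.toFun (Φ.symm.toFun x))) = s := by
      funext x
      exact congrArg s (Φ.right_inv x)
    rw [e] at h3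
    rw [IsAcceleration, ← h2, ← hsc]
    exact coeff_congr h3
  · rw [energy_congr hw]
    calc _ ≤ R * energy q s := (hRb Φ hM hEb s hss).1
      _ ≤ R * (K * (R * energy q v) ^ 2) := by
          gcongr
          refine hsE.trans ?_
          gcongr
          exact (hRb Φ hM hEb _ (sobolev_memSob v)).2
      _ = _ := by ring

end SprayBounded

end

open SprayBounded in
theorem theorem4p1 (a : ℤ → ℝ) (r q : ℝ) (ha : SprayBounded.IsInertia a r)
    (hq : 3 / 2 < q) (hrq : r ≤ q) :
    (∀ (φ : SprayBounded.D q) (v : SprayBounded.H q),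
      ∃! w : SprayBounded.H q, SprayBounded.IsAcceleration a φ v w) ∧
    ∀ B : Set (SprayBounded.D q × SprayBounded.H q), SprayBounded.IsBoundedSet B →
      Bornology.IsBounded (SprayBounded.spray a q '' B) := by
  have hex : ∀ (φ : D q) (v : H q), ∃! w : H q, IsAcceleration a φ v w := fun φ v => by
    obtain ⟨Φ, h1, h2, -, hs⟩ := φ.exists_circleDiffeo hq
    obtain ⟨M, hM⟩ := Φ.exists_jacBound
    obtain ⟨K, -, hK⟩ := exists_isAcceleration_bound ha hq hrq M (memSob_iff.1 hs).2
    obtain ⟨w, hw, -⟩ := hK φ Φ h1 h2 hM hs le_rfl v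
    exact ⟨w, hw, fun w' hw' => hw'.unique hq hw⟩
  refine ⟨hex, fun B hB => ?_⟩
  rcases B.eq_empty_or_nonempty with rfl | ⟨p₀, hp₀⟩
  · simp
  obtain ⟨C, hC⟩ := hB
  have hdq : ∀ φ ψ : D q, 0 ≤ dq φ ψ := fun φ ψ =>
    add_nonneg (add_nonneg (Real.iSup_nonneg fun x => norm_nonneg _) (sobNorm_nonneg _ _))
      (Real.iSup_nonneg fun x => abs_nonneg _)
  obtain ⟨M, E, hE, hME⟩ := exists_bounds_of_dq_le hq p₀.1 C
  obtain ⟨K, hK, hKb⟩ := exists_isAcceleration_bound ha hq hrq M hE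
  set V : ℝ := C + ‖p₀.2‖ with hV
  set Z : ℝ≥0∞ := K * ENNReal.ofReal (V ^ 2) ^ 2 with hZ
  have hZ' : Z ≠ ⊤ := by finiteness
  refine isBounded_iff_forall_norm_le.2 ⟨max V (Real.sqrt Z.toReal), ?_⟩
  rintro _ ⟨p, hp, rfl⟩
  have h1 := hC p hp p₀ hp₀
  have hv : ‖p.2‖ ≤ V := by
    have h2 := norm_sub_norm_le p.2 p₀.2
    have h3 := hdq p.1 p₀.1
    linarith
  obtain ⟨Φ, e1, e2, hj, hs⟩ := p.1.exists_circleDiffeo hq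
  obtain ⟨hM, hEb⟩ := hME p.1 (by linarith [norm_nonneg (p.2 - p₀.2)]) Φ hj hs
  obtain ⟨w, hw, hwE⟩ := hKb p.1 Φ e1 e2 hM hs hEb p.2
  have hacc : acceleration a p.1 p.2 = w := by
    have h4 : ∃ w : H q, IsAcceleration a p.1 p.2 w := ⟨w, hw⟩
    -- The chosen witness is `w` by uniqueness, so the default value `0` is not taken.
    rw [acceleration, dif_pos h4]
    exact h4.choose_spec.unique hq hw
  have hwn : ‖w‖ ≤ Real.sqrt Z.toReal := by
    refine Real.le_sqrt_of_sq_le ((ENNReal.ofReal_le_iff_le_toReal hZ').1 ?_)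
    rw [ofReal_norm_sq, hZ]
    refine hwE.trans ?_
    rw [← ofReal_norm_sq]
    gcongr
  rw [spray, hacc, Prod.norm_def]
  exact max_le_max hv hwn
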